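/- Let $\Omega,c,R>0$, and let $\boldsymbol x_1,\dots,\boldsymbol x_N\in\mathbb R^3$ be distinct, with $r_{j\ell}=|\boldsymbol x_j-\boldsymbol x_\ell|$. Put $f(k,r)=4\pi\,\frac{\sin(kr)}{kr}$ (equal to $4\pi$ when $kr=0$) and $$\Gamma_{j\ell}(s)=\frac1{ic}\int_0^\infty \frac{e^{-k^2R^2}}{\frac{s}{ic}+k}\,k^2 f(k,r_{j\ell})\,dk ,\qquad s\notin -i(0,\infty).$$ For $y>0$ let $A^{\mp}_{j\ell}(y)=\lim_{\varepsilon\to0^+} ic\,\Gamma_{j\ell}(-iy\pm\varepsilon)$, and denote by $A^\pm$ also the analytic continuations of these matrix-valued functions to $\mathbb C\setminus(-\infty,0]$; explicitly, $A^+_{j\ell}(y)$ equals $ic\,\Gamma_{j\ell}(-iy)$ for $\operatorname{Im}y<0$ and $ic\,\Gamma_{j\ell}(-iy)-2\pi i\,(y/c)^2e^{-y^2R^2/c^2}f(y/c,r_{j\ell})$ for $\operatorname{Im}y>0$, while $A^-_{j\ell}(y)$ equals $ic\,\Gamma_{j\ell}(-iy)$ for $\operatorname{Im}y>0$ and $ic\,\Gamma_{j\ell}(-iy)+2\pi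 i\,(y/c)^2e^{-y^2R^2/c^2}f(y/c,r_{j\ell})$ for $\operatorname{Im}y<0$. Let $\Omega_A=\{re^{i\theta}: r>0,\ -\pi/6\le\theta\le\pi/6\}$, let $D(\Omega,R_0)$ be the open disk of radius $R_0$ centered at $\Omega$, and put $$d_g^{\pm}(y)=\det\Big[(y-\Omega)I+\frac{g^2}{(2\pi)^3c}A^{\pm}(y)\Big].$$ Then there are $G_0>0$ and $0<R_0<\Omega\sin\frac{\pi}{8}$, depending only on $\Omega,c,R$ and $\boldsymbol x_1,\dots,\boldsymbol x_N$, such that for every $0<g<G_0$ the following holds. The functions $d_g^\pm$ are analytic on $\Omega_A\supset D(\Omega,R_0)$ (that is, in a neighborhood of each of its points). Counted with multiplicity, $d_g^+$ has exactly $N$ roots $y_1,\dots,y_N$ in $D(\Omega,R_0)$; they all lie in $\Omega_A$ and satisfy $\operatorname{Im}y_j>0$, and $d_g^+$ has no other roots in $\Omega_A$. Counted with multiplicity, $d_g^-$ has exactly $N$ roots in $D(\Omega,R_0)$, namely $\bar y_1,\dots,\bar y_N$, and no other roots in $\Omega_A$. -/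

import Mathlib

open Complex Filter Topology MeasureTheory

noncomputable section

namespace AtomField

/-- The function `f(k,r) = 4π sin(kr)/(kr)`, extended continuously by `4π` at `kr = 0`;
it is an entire function of the complex variable `k`. -/
def f (k : ℂ) (r : ℝ) : ℂ :=
  if k * r = 0 then 4 * Real.pi else 4 * Real.pi * Complex.sin (k * r) / (k * r)

/-- The function
`Γ(s) = (1 / (i c)) ∫₀^∞ e^{-k²R²} k² f(k,r) / (s/(i c) + k) dk`
for a pair of atoms at distance `r`; the integral converges absolutely for every `s` outside the
open negative imaginary axis. -/
def Gam (c R r : ℝ) (s : ℂ) : ℂ :=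
  1 / (I * c) *
    ∫ k in Set.Ioi (0 : ℝ),
      ((Real.exp (-(k ^ 2 * R ^ 2)) : ℝ) : ℂ) / (s / (I * c) + k) * (k : ℂ) ^ 2 * f k r

/-- The jump of `y ↦ i c Γ(-i y)` across the positive real axis (value above minus value below),
as an entire function of `y`: `2πi (y/c)² e^{-y²R²/c²} f(y/c, r)`. -/
def jump (c R r : ℝ) (y : ℂ) : ℂ :=
  2 * Real.pi * I * (y / c) ^ 2 * Complex.exp (-(y ^ 2 * R ^ 2 / c ^ 2)) * f (y / c) r

/-- Entry of `A⁺`: on the positive real axis it is the one-sided limit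
`lim_{ε → 0⁺} i c Γ(-i y - ε)`, and it is continued analytically from there: below the real axis
the continuation is `i c Γ(-i y)` itself, above the real axis the jump is subtracted. -/
def Aplus (c R r : ℝ) (y : ℂ) : ℂ :=
  if y.im < 0 then I * c * Gam c R r (-I * y)
  else if 0 < y.im then I * c * Gam c R r (-I * y) - jump c R r y
  else limUnder (𝓝[>] (0 : ℝ)) fun ε : ℝ => I * c * Gam c R r (-I * y - ε)

/-- Entry of `A⁻`: on the positive real axis it is the one-sided limit
`lim_{ε → 0⁺} i c Γ(-i y + ε)`, and it is continued analytically from there: above the real axis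
the continuation is `i c Γ(-i y)` itself, below the real axis the jump is added. -/
def Aminus (c R r : ℝ) (y : ℂ) : ℂ :=
  if 0 < y.im then I * c * Gam c R r (-I * y)
  else if y.im < 0 then I * c * Gam c R r (-I * y) + jump c R r y
  else limUnder (𝓝[>] (0 : ℝ)) fun ε : ℝ => I * c * Gam c R r (-I * y + ε)

/-- The matrix `A⁺(y)` of the atoms at `x₁, …, x_N`, with `r_{jℓ} = |x_j - x_ℓ|`. -/
def AplusMatrix {N : ℕ} (c R : ℝ) (x : Fin N → EuclideanSpace ℝ (Fin 3)) (y : ℂ) :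
    Matrix (Fin N) (Fin N) ℂ :=
  Matrix.of fun j l => Aplus c R (dist (x j) (x l)) y

/-- The matrix `A⁻(y)` of the atoms at `x₁, …, x_N`. -/
def AminusMatrix {N : ℕ} (c R : ℝ) (x : Fin N → EuclideanSpace ℝ (Fin 3)) (y : ℂ) :
    Matrix (Fin N) (Fin N) ℂ :=
  Matrix.of fun j l => Aminus c R (dist (x j) (x l)) y

/-- `det[(y - Ω) I + g²/((2π)³ c) A(y)]` for a matrix-valued function `A`. -/
def resDet {N : ℕ} (Ω c g : ℝ) (A : ℂ → Matrix (Fin N) (Fin N) ℂ) (y : ℂ) : ℂ :=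
  ((y - Ω) • (1 : Matrix (Fin N) (Fin N) ℂ)
    + ((g ^ 2 / ((2 * Real.pi) ^ 3 * c) : ℝ) : ℂ) • A y).det

/-- The closed sector `Ω_A` of half-opening `π/6` around the positive real axis, without its
vertex. -/
def sectorA : Set ℂ :=
  {z | ∃ ρ θ : ℝ, 0 < ρ ∧ -(Real.pi / 6) ≤ θ ∧ θ ≤ Real.pi / 6 ∧ z = ρ * Complex.exp (θ * I)}

/-- `y₁, …, y_N` are all the roots of `F` in `S`, each listed as often as its multiplicity:
`F` is analytic at the points of `S`, the `y_j` are in `S`, the zeros of `F` in `S` are exactly the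
`y_j`, and the order of vanishing of `F` at any `z ∈ S` is the number of `j` with `y_j = z`. -/
def ListsRoots {N : ℕ} (F : ℂ → ℂ) (S : Set ℂ) (y : Fin N → ℂ) : Prop :=
  AnalyticOnNhd ℂ F S ∧ (∀ j, y j ∈ S) ∧
    ∀ z ∈ S, (F z = 0 ↔ ∃ j, y j = z) ∧
      analyticOrderAt F z = ((Finset.univ.filter fun j => y j = z).card : ℕ∞)

end AtomField

end

namespace AtomField

/-! On the sector, `A⁺` is a Cauchy integral over the half line `k > 0`, continued from below
through the cut. Rotating the half line to the direction `(4 + 3i)/5`, above the sector, replaces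
the three-case definition by the single formula `Aplus_eq_rayCauchy`. The slope `3/4` of that
direction exceeds the slope `2/3` of `openSector`, so the pole is never met. It is below `1`, so the
Gaussian still decays on the ray. The resulting function is holomorphic on `openSector`
(`differentiableOn_rayCauchy`) and bounded there uniformly up to the vertex (`norm_rayCauchy_le`),
because the numerator is `O(|k|)` at `0`.

With `ε = g²/((2π)³c)`, the determinant divided by `(y - Ω)^N` is `det(I + ε A⁺(y)/(y - Ω))`. The
uniform bound keeps it within distance one of `1` on all of the sector outside the open disk of
radius `R₀`, once `g` is small. So there are no zeros outside that disk, and `exists_roots_in_ball`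
(Rouché) gives exactly `N` inside it.

For the sign of `Im y`, pair `((y - Ω) + ε A⁺(y)) v = 0` with `v`: `Im y · |v|² = -ε Im ⟨v, A⁺(y)
v⟩`. At `y = Ω` the jump formula turns `Im ⟨v, A⁺ v⟩` into a negative multiple of the quadratic form
of `f(Ω/c, |x_j - x_ℓ|)`. This kernel is the Fourier transform of the surface measure of the unit
sphere (`f_eq_integral_toSphere`), hence strictly positive definite, since plane waves at distinct
points are linearly independent on the sphere (`re_sum_f_dist_pos`). By compactness the negativity
persists near `Ω`, and `R₀` is chosen accordingly.

The statement for `A⁻` follows from `A⁻(ȳ)` being the entrywise conjugate of `A⁺(y)`. -/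

/-! ### Sectors and rotation of the contour -/

/-- The direction `(4 + 3i)/5` of the rotated contour. -/
noncomputable def ray : ℂ := ⟨4 / 5, 3 / 5⟩

/-- The closed sector between the positive real axis and the ray in direction `ray`. -/
noncomputable def raySector : Set ℂ := {k | 0 ≤ k.im ∧ 4 * k.im ≤ 3 * k.re}

/-- The open sector `|Im z| < (2/3) Re z`, a neighbourhood of `sectorA`. -/
def openSector : Set ℂ := {z | |z.im| < 2 / 3 * z.re}

lemma norm_ray : ‖ray‖ = 1 := by
  rw [← sq_eq_sq₀ (norm_nonneg _) zero_le_one, Complex.sq_norm, normSq_apply]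
  norm_num [ray]

lemma ray_ne_zero : ray ≠ 0 := by
  intro h; simpa [h] using norm_ray

lemma convex_raySector : Convex ℝ raySector := by
  intro a ha b hb s t hs ht _
  simp only [raySector, Set.mem_ofPred_eq] at *
  simp only [add_im, real_smul, mul_im, ofReal_re, ofReal_im, zero_mul, add_zero, add_re, mul_re,
    sub_zero]
  constructor
  · nlinarith [mul_nonneg hs ha.1, mul_nonneg ht hb.1]
  · nlinarith [mul_le_mul_of_nonneg_left ha.2 hs, mul_le_mul_of_nonneg_left hb.2 ht]

lemma isClosed_raySector : IsClosed raySector :=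
  (isClosed_le continuous_const continuous_im).inter
    (isClosed_le (continuous_const.mul continuous_im) (continuous_const.mul continuous_re))

lemma ofReal_mem_raySector {t : ℝ} (ht : 0 ≤ t) : (t : ℂ) ∈ raySector := by
  simp [raySector, ht]

lemma ray_mul_mem_raySector {t : ℝ} (ht : 0 ≤ t) : ray * t ∈ raySector := by
  simp only [raySector, ray, Set.mem_ofPred_eq, mul_im, mul_re, ofReal_re, ofReal_im]
  constructor <;> linarith

lemma re_nonneg_of_mem_raySector {k : ℂ} (hk : k ∈ raySector) : 0 ≤ k.re := by
  have h1 := hk.1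
  have h2 := hk.2
  linarith

lemma integrableOn_Ioi_of_norm_le {g : ℝ → ℂ} {C : ℝ} (hg : ContinuousOn g (Set.Ici 0))
    (hC : ∀ t, 0 ≤ t → ‖g t‖ * (1 + t ^ 2) ≤ C) : IntegrableOn g (Set.Ioi 0) := by
  refine Integrable.mono' (g := fun t : ℝ => C * (1 + t ^ 2)⁻¹)
    ((integrable_inv_one_add_sq.const_mul C).integrableOn)
    ((hg.mono Set.Ioi_subset_Ici_self).aestronglyMeasurable measurableSet_Ioi) ?_
  refine (ae_restrict_mem measurableSet_Ioi).mono fun t ht => ?_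
  rw [← div_eq_mul_inv, le_div_iff₀ (by positivity)]
  exact hC t (le_of_lt ht)

/-- Rotation of the half line of integration in the right half-plane. -/
theorem integral_Ioi_eq_integral_ray {F : ℂ → ℂ} {C : ℝ}
    (hF : DifferentiableOn ℂ F {k | -1 < k.re})
    (hC : ∀ k ∈ raySector, ‖F k‖ * (1 + ‖k‖ ^ 2) ≤ C) :
    IntegrableOn (fun t : ℝ => F t) (Set.Ioi 0) ∧
    IntegrableOn (fun t : ℝ => ray * F (ray * t)) (Set.Ioi 0) ∧
    ∫ t in Set.Ioi (0 : ℝ), F t = ∫ t in Set.Ioi (0 : ℝ), ray * F (ray * t) := by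
  have hcont : ContinuousOn F raySector := hF.continuousOn.mono fun k hk => by
    have := re_nonneg_of_mem_raySector hk
    show -1 < k.re
    linarith
  have hi1 : IntegrableOn (fun t : ℝ => F t) (Set.Ioi 0) := by
    refine integrableOn_Ioi_of_norm_le (C := C)
      (hcont.comp (by fun_prop) fun t ht => ofReal_mem_raySector ht) fun t ht => ?_
    simpa using hC t (ofReal_mem_raySector ht)
  have hi2 : IntegrableOn (fun t : ℝ => ray * F (ray * t)) (Set.Ioi 0) := by
    refine integrableOn_Ioi_of_norm_le (C := C)
      (continuousOn_const.mul (hcont.comp (by fun_prop) fun t ht => ray_mul_mem_raySector ht))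
      fun t ht => ?_
    simpa [norm_ray] using hC _ (ray_mul_mem_raySector ht)
  refine ⟨hi1, hi2, ?_⟩
  have l1 := intervalIntegral_tendsto_integral_Ioi 0 hi1 tendsto_id
  have l2 := intervalIntegral_tendsto_integral_Ioi 0 hi2 tendsto_id
  rw [← sub_eq_zero]
  refine tendsto_nhds_unique (l1.sub l2) ?_
  have hC0 : 0 ≤ C := le_trans (by positivity) (hC 0 (by simp [raySector]))
  refine squeeze_zero_norm' (a := fun T : ℝ => 2 * C / T) ?_
    (tendsto_const_nhds.div_atTop tendsto_id)
  filter_upwards [eventually_ge_atTop (1 : ℝ)] with T hT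
  simp only [id]
  -- This disk contains `0`, `T` and `ray * T` and stays inside `Re k > -1`. A primitive on it
  -- reduces the difference of the two truncated integrals to `Q T - Q (ray * T)`, estimated along
  -- the chord.
  obtain ⟨Q, hQ⟩ := (hF.mono (s := Metric.ball (T : ℂ) (T + 1 / 2)) (by
    intro k hk
    rw [Metric.mem_ball, dist_eq] at hk
    have := (abs_le.1 (abs_re_le_norm (k - T))).1
    simp only [sub_re, ofReal_re] at this
    show -1 < k.re
    linarith)).isExactOn_ball
  have hdist : ‖ray - 1‖ ≤ 1 := by
    rw [← sq_le_sq₀ (norm_nonneg _) zero_le_one, Complex.sq_norm, normSq_apply]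
    norm_num [ray]
  have hm1 : ∀ t : ℝ, 0 ≤ t → t ≤ T → (t : ℂ) ∈ Metric.ball (T : ℂ) (T + 1 / 2) := by
    intro t h0 h1
    rw [Metric.mem_ball, dist_eq, ← ofReal_sub, norm_real, Real.norm_eq_abs, abs_lt]
    constructor <;> linarith
  have hm2 : ∀ t : ℝ, 0 ≤ t → t ≤ T → ray * t ∈ Metric.ball (T : ℂ) (T + 1 / 2) := by
    intro t h0 h1
    rw [Metric.mem_ball, dist_eq]
    have e : ray * t - T = (ray - 1) * t + ((t - T : ℝ) : ℂ) := by push_cast; ring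
    have n1 : ‖(ray - 1) * t‖ ≤ t := by
      rw [norm_mul, norm_real, Real.norm_of_nonneg h0]
      nlinarith
    have n2 : ‖((t - T : ℝ) : ℂ)‖ = T - t := by
      rw [norm_real, Real.norm_eq_abs, abs_of_nonpos (by linarith)]; ring
    rw [e]
    refine (norm_add_le _ _).trans_lt ?_
    rw [n2]
    linarith
  have e1 : ∫ t in (0 : ℝ)..T, F t = Q T - Q 0 := by
    have := intervalIntegral.integral_eq_sub_of_hasDerivAt (a := 0) (b := T)
      (f := fun t : ℝ => Q t) (f' := fun t : ℝ => F t) (fun t ht => by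
        rw [Set.uIcc_of_le (by linarith)] at ht
        exact (hQ _ (hm1 t ht.1 ht.2)).comp_ofReal)
      ((intervalIntegrable_iff_integrableOn_Ioc_of_le (by linarith)).2
        (hi1.mono_set Set.Ioc_subset_Ioi_self))
    simpa using this
  have e2 : ∫ t in (0 : ℝ)..T, ray * F (ray * t) = Q (ray * T) - Q 0 := by
    have := intervalIntegral.integral_eq_sub_of_hasDerivAt (a := 0) (b := T)
      (f := fun t : ℝ => Q (ray * t)) (f' := fun t : ℝ => ray * F (ray * t)) (fun t ht => by
        rw [Set.uIcc_of_le (by linarith)] at ht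
        have h1 : HasDerivAt (fun s : ℝ => ray * (s : ℂ)) ray t := by
          simpa using (hasDerivAt_id t).ofReal_comp.const_mul ray
        have := (hQ _ (hm2 t ht.1 ht.2)).comp t h1
        rwa [mul_comm] at this)
      ((intervalIntegrable_iff_integrableOn_Ioc_of_le (by linarith)).2
        (hi2.mono_set Set.Ioc_subset_Ioi_self))
    simpa using this
  rw [e1, e2, sub_sub_sub_cancel_right]
  have hseg : segment ℝ (ray * T) (T : ℂ) ⊆
      Metric.ball (T : ℂ) (T + 1 / 2) ∩ (raySector ∩ {k | 4 / 5 * T ≤ k.re}) := by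
    refine Convex.segment_subset ?_ ⟨hm2 T (by linarith) le_rfl,
      ray_mul_mem_raySector (by linarith), ?_⟩ ⟨hm1 T (by linarith) le_rfl,
      ofReal_mem_raySector (by linarith), ?_⟩
    · exact (convex_ball _ _).inter (convex_raySector.inter (convex_halfSpace_re_ge _))
    · simp [ray]
    · simp only [Set.mem_ofPred_eq, ofReal_re]; linarith
  have := (convex_segment (𝕜 := ℝ) (ray * T) (T : ℂ)).norm_image_sub_le_of_norm_hasDerivWithin_le
    (f := Q) (f' := F) (C := 2 * C / T ^ 2) (fun k hk => (hQ k (hseg hk).1).hasDerivWithinAt)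
    (fun k hk => by
      obtain ⟨-, hk1, hk2⟩ := hseg hk
      have h1 := hC k hk1
      have h2 : 4 / 5 * T ≤ ‖k‖ := hk2.trans (re_le_norm k)
      rw [le_div_iff₀ (by positivity)]
      -- On the chord `‖k‖ ≥ 4T/5`, and `2 * (4/5)^2 > 1`. So `F` is `O(T⁻²)` on a path of length at
      -- most `T`.
      have h3 : T ^ 2 ≤ 2 * (1 + ‖k‖ ^ 2) := by nlinarith
      nlinarith [norm_nonneg (F k)])
    (left_mem_segment _ _ _) (right_mem_segment _ _ _)
  refine this.trans ?_
  have hn : ‖(T : ℂ) - ray * T‖ ≤ T := by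
    rw [show (T : ℂ) - ray * T = -((ray - 1) * T) by ring, norm_neg, norm_mul, norm_real,
      Real.norm_of_nonneg (by linarith)]
    nlinarith
  calc 2 * C / T ^ 2 * ‖(T : ℂ) - ray * T‖ ≤ 2 * C / T ^ 2 * T := by gcongr
    _ = 2 * C / T := by field_simp

/-! ### Logarithmic integrals over the half line -/

/-- A point of the slit plane stays away from the negative half line at a linear rate. -/
lemma exists_one_add_le_norm_add {w : ℂ} (hw : w ∈ slitPlane) :
    ∃ B : ℝ, 0 < B ∧ ∀ t : ℝ, 0 ≤ t → 1 + t ≤ B * ‖(t : ℂ) + w‖ := by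
  obtain ⟨δ, hδ, h⟩ : ∃ δ : ℝ, 0 < δ ∧ ∀ t : ℝ, 0 ≤ t → δ ≤ ‖(t : ℂ) + w‖ := by
    rcases hw with h | h
    · refine ⟨w.re, h, fun t ht => le_trans ?_ (re_le_norm _)⟩
      simp [ht]
    · refine ⟨|w.im|, abs_pos.2 h, fun t ht => le_trans ?_ (abs_im_le_norm _)⟩
      simp
  refine ⟨1 + ‖1 - w‖ / δ, by positivity, fun t ht => ?_⟩
  have h1 : 1 + t ≤ ‖(t : ℂ) + w‖ + ‖1 - w‖ := by
    refine le_trans ?_ (norm_add_le _ _)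
    rw [show (t : ℂ) + w + (1 - w) = ((1 + t : ℝ) : ℂ) by push_cast; ring, norm_real,
      Real.norm_of_nonneg (by linarith)]
  have h2 : ‖1 - w‖ ≤ ‖1 - w‖ / δ * ‖(t : ℂ) + w‖ := by
    rw [div_mul_eq_mul_div, le_div_iff₀ hδ]
    gcongr
    exact h t ht
  linarith

/-- For `t > 0` the principal branch satisfies `log (t + w) = log t + log (1 + w/t)`. Subtracting
two instances shows that the primitive of the Frullani integrand vanishes at infinity. -/
lemma tendsto_log_ofReal_add_sub_log (w : ℂ) :
    Tendsto (fun t : ℝ => log ((t : ℂ) + w) - (Real.log t : ℂ)) atTop (𝓝 0) := by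
  have h1 : Tendsto (fun t : ℝ => 1 + w / (t : ℂ)) atTop (𝓝 1) := by
    have : Tendsto (fun t : ℝ => w * ((t⁻¹ : ℝ) : ℂ)) atTop (𝓝 (w * ((0 : ℝ) : ℂ))) :=
      ((continuous_ofReal.tendsto _).comp tendsto_inv_atTop_zero).const_mul w
    simpa [div_eq_mul_inv] using this.const_add 1
  have h2 : Tendsto (fun t : ℝ => log (1 + w / (t : ℂ))) atTop (𝓝 (log 1)) :=
    (continuousAt_clog (by simp)).tendsto.comp h1
  rw [log_one] at h2
  refine h2.congr' ?_
  filter_upwards [eventually_gt_atTop 0, h1.eventually_ne one_ne_zero] with t ht hne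
  have : (t : ℂ) + w = (t : ℂ) * (1 + w / t) := by
    have : (t : ℂ) ≠ 0 := by exact_mod_cast ht.ne'
    field_simp
  rw [this, log_ofReal_mul ht hne]
  ring

lemma add_mem_slitPlane {w : ℂ} (hw : w ∈ slitPlane) {t : ℝ} (ht : 0 ≤ t) :
    (t : ℂ) + w ∈ slitPlane := by
  rcases hw with h | h
  · left; simp; linarith
  · right; simpa using h

/-- A Frullani-type integral evaluated by logarithms. -/
theorem integral_Ioi_inv_sub_inv {w₁ w₂ : ℂ} (h₁ : w₁ ∈ slitPlane) (h₂ : w₂ ∈ slitPlane) :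
    IntegrableOn (fun t : ℝ => ((t : ℂ) + w₁)⁻¹ - ((t : ℂ) + w₂)⁻¹) (Set.Ioi 0) ∧
    ∫ t in Set.Ioi (0 : ℝ), (((t : ℂ) + w₁)⁻¹ - ((t : ℂ) + w₂)⁻¹) = log w₂ - log w₁ := by
  have hne : ∀ {w : ℂ}, w ∈ slitPlane → ∀ {t : ℝ}, 0 ≤ t → (t : ℂ) + w ≠ 0 := fun hw t ht =>
    slitPlane_ne_zero (add_mem_slitPlane hw ht)
  have hint : IntegrableOn (fun t : ℝ => ((t : ℂ) + w₁)⁻¹ - ((t : ℂ) + w₂)⁻¹) (Set.Ioi 0) := by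
    obtain ⟨B₁, hB₁, hb₁⟩ := exists_one_add_le_norm_add h₁
    obtain ⟨B₂, hB₂, hb₂⟩ := exists_one_add_le_norm_add h₂
    refine integrableOn_Ioi_of_norm_le (C := ‖w₂ - w₁‖ * (B₁ * B₂)) ?_ fun t ht => ?_
    · refine ContinuousOn.sub ?_ ?_
      · exact ContinuousOn.inv₀ (by fun_prop) fun t ht => hne h₁ ht
      · exact ContinuousOn.inv₀ (by fun_prop) fun t ht => hne h₂ ht
    · rw [inv_sub_inv (hne h₁ ht) (hne h₂ ht), norm_div, norm_mul, div_mul_eq_mul_div,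
        div_le_iff₀ (mul_pos (norm_pos_iff.2 (hne h₁ ht)) (norm_pos_iff.2 (hne h₂ ht))),
        add_sub_add_left_eq_sub, mul_assoc]
      gcongr
      calc 1 + t ^ 2 ≤ (1 + t) * (1 + t) := by nlinarith
        _ ≤ (B₁ * ‖(t : ℂ) + w₁‖) * (B₂ * ‖(t : ℂ) + w₂‖) := by
          gcongr
          · exact hb₁ t ht
          · exact hb₂ t ht
        _ = _ := by ring
  refine ⟨hint, ?_⟩
  have hd : ∀ {w : ℂ}, w ∈ slitPlane → ∀ {t : ℝ}, 0 ≤ t →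
      HasDerivAt (fun s : ℝ => log ((s : ℂ) + w)) ((t : ℂ) + w)⁻¹ t := fun {w} hw t ht => by
    have h : HasDerivAt (fun s : ℝ => (s : ℂ) + w) 1 t := by
      simpa using (hasDerivAt_id t).ofReal_comp.add_const w
    simpa using h.clog_real (add_mem_slitPlane hw ht)
  have := integral_Ioi_of_hasDerivAt_of_tendsto' (a := 0)
    (f := fun t : ℝ => log ((t : ℂ) + w₁) - log ((t : ℂ) + w₂)) (m := 0)
    (f' := fun t : ℝ => ((t : ℂ) + w₁)⁻¹ - ((t : ℂ) + w₂)⁻¹)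
    (fun t ht => (hd h₁ ht).sub (hd h₂ ht)) hint (by
      simpa using (tendsto_log_ofReal_add_sub_log w₁).sub (tendsto_log_ofReal_add_sub_log w₂))
  rw [this]
  simp

/-! ### Cauchy integrals over the half line and the rotated ray -/

/-- The Cauchy integral `∫₀^∞ h(k)/(k - z) dk` over the half line. -/
noncomputable def lineCauchy (h : ℂ → ℂ) (z : ℂ) : ℂ :=
  ∫ t in Set.Ioi (0 : ℝ), h t / (t - z)

/-- The Cauchy integral `∫ h(k)/(k - z) dk` over the half line in direction `ray`. -/
noncomputable def rayCauchy (h : ℂ → ℂ) (z : ℂ) : ℂ :=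
  ∫ t in Set.Ioi (0 : ℝ), ray * (h (ray * t) / (ray * t - z))

lemma isOpen_openSector : IsOpen openSector :=
  isOpen_lt (continuous_abs.comp continuous_im) (continuous_const.mul continuous_re)

lemma re_pos_of_mem_openSector {z : ℂ} (hz : z ∈ openSector) : 0 < z.re := by
  have h : |z.im| < 2 / 3 * z.re := hz
  have := abs_nonneg z.im
  linarith

/-- The imaginary part of `conj ray * (ray * t - z)` is the distance from `z` to the line through
`ray`, namely `(3 Re z - 4 Im z)/5`. This exceeds `(3 - 8/3)/5 · Re z = Re z / 15`. -/
lemma re_div_le_norm_ray_mul_sub {z : ℂ} (hz : z ∈ openSector) (t : ℝ) :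
    z.re / 15 ≤ ‖ray * t - z‖ := by
  have h : |z.im| < 2 / 3 * z.re := hz
  have h2 := (abs_lt.1 h).2
  have e : ‖ray * t - z‖ = ‖(starRingEnd ℂ) ray * (ray * t - z)‖ := by
    rw [norm_mul, norm_conj, norm_ray, one_mul]
  rw [e]
  refine le_trans ?_ (abs_im_le_norm _)
  refine le_trans ?_ (le_abs_self _)
  simp only [ray, mul_im, conj_re, conj_im, sub_im, sub_re, mul_re, ofReal_re, ofReal_im]
  linarith

lemma ray_mul_sub_ne_zero {z : ℂ} (hz : z ∈ openSector) (t : ℝ) : ray * t - z ≠ 0 := by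
  have h1 := re_div_le_norm_ray_mul_sub hz t
  have h2 := re_pos_of_mem_openSector hz
  rw [← norm_pos_iff]
  linarith

/-- Here `t ≤ ‖ray * t - z‖ + ‖z‖` and `‖z‖ ≤ 2 Re z ≤ 30 ‖ray * t - z‖`. The estimate is scale
invariant, so a numerator of size `‖k‖` absorbs the denominator uniformly as `z` approaches the
vertex. -/
lemma le_norm_ray_mul_sub {z : ℂ} (hz : z ∈ openSector) {t : ℝ} (ht : 0 ≤ t) :
    t ≤ 31 * ‖ray * t - z‖ := by
  have h1 := re_div_le_norm_ray_mul_sub hz t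
  have h3 : |z.im| < 2 / 3 * z.re := hz
  have h4 : ‖z‖ ≤ 2 * z.re := by
    have := norm_le_abs_re_add_abs_im z
    have h0 := re_pos_of_mem_openSector hz
    rw [abs_of_pos h0] at this
    linarith
  have h5 : t ≤ ‖ray * t - z‖ + ‖z‖ := by
    refine le_trans (le_of_eq ?_) (norm_add_le _ _)
    rw [sub_add_cancel, norm_mul, norm_ray, one_mul, norm_real, Real.norm_of_nonneg ht]
  linarith

lemma integrableOn_exp_neg_Ioi : IntegrableOn (fun t : ℝ => Real.exp (-t)) (Set.Ioi 0) := by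
  simpa using exp_neg_integrableOn_Ioi 0 (b := 1) one_pos

section
variable {h : ℂ → ℂ} {C : ℝ}

lemma constant_nonneg_of_bound (hb : ∀ k ∈ raySector, ‖h k‖ ≤ C * ‖k‖ * Real.exp (-‖k‖)) :
    0 ≤ C := by
  have h1 := (norm_nonneg _).trans (hb ((1 : ℝ) : ℂ) (ofReal_mem_raySector zero_le_one))
  have h2 : (0 : ℝ) < Real.exp (-1) := Real.exp_pos _
  simp only [norm_real, norm_one, mul_one] at h1
  nlinarith

lemma continuous_comp_ray (hh : Differentiable ℂ h) : Continuous fun t : ℝ => h (ray * t) :=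
  hh.continuous.comp (by fun_prop)

lemma norm_rayCauchy_integrand_le (hb : ∀ k ∈ raySector, ‖h k‖ ≤ C * ‖k‖ * Real.exp (-‖k‖))
    {z : ℂ} (hz : z ∈ openSector) {t : ℝ} (ht : 0 ≤ t) :
    ‖ray * (h (ray * t) / (ray * t - z))‖ ≤ 31 * C * Real.exp (-t) := by
  have hC := constant_nonneg_of_bound hb
  have h1 := hb _ (ray_mul_mem_raySector ht)
  rw [norm_mul ray (t : ℂ), norm_ray, one_mul, norm_real, Real.norm_of_nonneg ht] at h1
  rw [norm_mul, norm_ray, one_mul, norm_div,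
    div_le_iff₀ (norm_pos_iff.2 (ray_mul_sub_ne_zero hz t))]
  refine h1.trans ?_
  calc C * t * Real.exp (-t) ≤ C * (31 * ‖ray * t - z‖) * Real.exp (-t) := by
        gcongr
        exact le_norm_ray_mul_sub hz ht
    _ = _ := by ring

lemma continuous_rayCauchy_integrand (hh : Differentiable ℂ h) {z : ℂ} (hz : z ∈ openSector) :
    Continuous fun t : ℝ => ray * (h (ray * t) / (ray * t - z)) :=
  continuous_const.mul ((continuous_comp_ray hh).div (by fun_prop) (ray_mul_sub_ne_zero hz))

lemma integrableOn_rayCauchy (hh : Differentiable ℂ h)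
    (hb : ∀ k ∈ raySector, ‖h k‖ ≤ C * ‖k‖ * Real.exp (-‖k‖)) {z : ℂ} (hz : z ∈ openSector) :
    IntegrableOn (fun t : ℝ => ray * (h (ray * t) / (ray * t - z))) (Set.Ioi 0) := by
  refine Integrable.mono' (integrableOn_exp_neg_Ioi.const_mul (31 * C))
    (continuous_rayCauchy_integrand hh hz).aestronglyMeasurable ?_
  exact (ae_restrict_mem measurableSet_Ioi).mono fun t ht =>
    norm_rayCauchy_integrand_le hb hz (le_of_lt ht)

/-- The rotated Cauchy integral is uniformly bounded on the sector. -/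
theorem norm_rayCauchy_le (hb : ∀ k ∈ raySector, ‖h k‖ ≤ C * ‖k‖ * Real.exp (-‖k‖))
    {z : ℂ} (hz : z ∈ openSector) : ‖rayCauchy h z‖ ≤ 31 * C := by
  have := norm_integral_le_of_norm_le (integrableOn_exp_neg_Ioi.const_mul (31 * C))
    ((ae_restrict_mem measurableSet_Ioi).mono fun t (ht : 0 < t) =>
    norm_rayCauchy_integrand_le hb hz ht.le)
  refine this.trans_eq ?_
  rw [integral_const_mul, integral_exp_neg_Ioi_zero, mul_one]

theorem differentiableOn_rayCauchy (hh : Differentiable ℂ h)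
    (hb : ∀ k ∈ raySector, ‖h k‖ ≤ C * ‖k‖ * Real.exp (-‖k‖)) :
    DifferentiableOn ℂ (rayCauchy h) openSector := by
  intro z₀ hz₀
  have hC := constant_nonneg_of_bound hb
  have hre := re_pos_of_mem_openSector hz₀
  have hs : openSector ∩ {z | z₀.re / 2 < z.re} ∈ 𝓝 z₀ :=
    (isOpen_openSector.inter (isOpen_lt continuous_const continuous_re)).mem_nhds
      ⟨hz₀, by simp only [Set.mem_ofPred_eq]; linarith⟩
  have := hasDerivAt_integral_of_dominated_loc_of_deriv_le (𝕜 := ℂ)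
    (μ := volume.restrict (Set.Ioi (0 : ℝ))) (x₀ := z₀)
    (F := fun z (t : ℝ) => ray * (h (ray * t) / (ray * t - z)))
    (F' := fun z (t : ℝ) => ray * (h (ray * t) / (ray * t - z) ^ 2))
    (bound := fun t => 31 * C * Real.exp (-t) * (30 / z₀.re)) hs
    (Filter.eventually_of_mem hs fun z hz =>
      (continuous_rayCauchy_integrand hh hz.1).aestronglyMeasurable)
    (integrableOn_rayCauchy hh hb hz₀)
    ((continuous_const.mul ((continuous_comp_ray hh).div (by fun_prop)
      fun t => pow_ne_zero 2 (ray_mul_sub_ne_zero hz₀ t))).aestronglyMeasurable)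
    ((ae_restrict_mem measurableSet_Ioi).mono fun t ht z hz => by
      have h1 := norm_rayCauchy_integrand_le hb hz.1 (le_of_lt ht)
      have h2 := re_div_le_norm_ray_mul_sub hz.1 t
      have h3 : z₀.re / 2 < z.re := hz.2
      have h4 : ‖(ray * t - z)⁻¹‖ ≤ 30 / z₀.re := by
        rw [norm_inv, ← inv_div]
        exact inv_anti₀ (by positivity) (by linarith)
      calc ‖ray * (h (ray * t) / (ray * t - z) ^ 2)‖
          = ‖ray * (h (ray * t) / (ray * t - z))‖ * ‖(ray * t - z)⁻¹‖ := by
            rw [← norm_mul]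
            congr 1
            have := ray_mul_sub_ne_zero hz.1 t
            field_simp
        _ ≤ _ := by gcongr)
    ((integrableOn_exp_neg_Ioi.const_mul (31 * C)).mul_const _)
    ((ae_restrict_mem measurableSet_Ioi).mono fun t ht z hz => by
      have h0 := ray_mul_sub_ne_zero hz.1 t
      have h1 : HasDerivAt (fun z : ℂ => ray * t - z) (-1) z := by
        simpa using (hasDerivAt_id z).const_sub (ray * t)
      have := ((h1.inv h0).const_mul (h (ray * t))).const_mul ray
      simp only [neg_neg, one_div, ← div_eq_mul_inv] at this
      exact this)
  exact this.2.differentiableAt.differentiableWithinAt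

lemma sq_mul_exp_neg_le {s : ℝ} (hs : 0 ≤ s) : s ^ 2 * Real.exp (-s) ≤ 2 := by
  have h1 := Real.quadratic_le_exp_of_nonneg hs
  rw [Real.exp_neg, ← div_eq_mul_inv, div_le_iff₀ (Real.exp_pos s)]
  nlinarith

/-- Moving the half line of integration across the pole at `z`, up to the logarithmic terms. -/
theorem lineCauchy_sub_rayCauchy (hh : Differentiable ℂ h)
    (hb : ∀ k ∈ raySector, ‖h k‖ ≤ C * ‖k‖ * Real.exp (-‖k‖)) {z : ℂ} (hz : z ∈ openSector)
    (hz' : z.im ≠ 0) :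
    lineCauchy h z - rayCauchy h z =
      h z * (log (-z / ray) - log (1 / ray) - log (-z)) := by
  have hC := constant_nonneg_of_bound hb
  have hre := re_pos_of_mem_openSector hz
  have hz1 : z + 1 ≠ 0 := by
    intro h0
    have := congrArg Complex.re h0
    simp at this
    linarith
  -- The correction cancels the pole at `z` while leaving `g(k)/(k - z) = O(|k|⁻²)`, so the rotation
  -- theorem applies to the difference quotient. Its own pole, at `-1`, is outside `Re k > -1`. What
  -- was removed is `h z * (1/(k - z) - 1/(k + 1))`, integrated explicitly by logarithms; this takes
  -- the place of a residue computation.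
  set g : ℂ → ℂ := fun k => h k - h z * ((z + 1) / (k + 1)) with hg
  have hne : ∀ k : ℂ, -1 < k.re → k + 1 ≠ 0 := fun k hk h0 => by
    have := congrArg Complex.re h0
    simp at this
    linarith
  have hopen : IsOpen {k : ℂ | -1 < k.re} := isOpen_lt continuous_const continuous_re
  have hgd : DifferentiableOn ℂ g {k | -1 < k.re} := by
    intro k hk
    refine (hh k).differentiableWithinAt.sub ?_
    refine DifferentiableWithinAt.const_mul ?_ _
    exact DifferentiableWithinAt.div (by fun_prop) (by fun_prop) (hne k hk)
  have hgz : g z = 0 := by simp [hg, hz1]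
  have hqd : DifferentiableOn ℂ (dslope g z) {k | -1 < k.re} :=
    (differentiableOn_dslope (hopen.mem_nhds (by
      show -1 < z.re
      linarith))).2 hgd
  have hq : ∀ k, k ≠ z → dslope g z k = h k / (k - z) - h z * ((z + 1) / (k + 1) / (k - z)) := by
    intro k hk
    rw [dslope_of_ne _ hk, slope_def_field, hgz, sub_zero, hg]
    ring
  have hsub : ∀ k ∈ raySector, -1 < k.re := fun k hk => by
    have := re_nonneg_of_mem_raySector hk
    linarith
  obtain ⟨B, hB⟩ : ∃ B, ∀ k ∈ raySector, ‖dslope g z k‖ * (1 + ‖k‖ ^ 2) ≤ B := by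
    obtain ⟨B₁, hB₁⟩ := (isCompact_closedBall (0 : ℂ) (2 * ‖z‖ + 1)).inter_right
      isClosed_raySector |>.exists_bound_of_continuousOn (f := fun k => dslope g z k)
      (hqd.continuousOn.mono fun k hk => hsub k hk.2)
    refine ⟨max (B₁ * (1 + (2 * ‖z‖ + 1) ^ 2)) (4 * (2 * C + ‖h z‖ * ‖z + 1‖)), fun k hk => ?_⟩
    by_cases hk2 : ‖k‖ ≤ 2 * ‖z‖ + 1
    · refine le_trans ?_ (le_max_left _ _)
      have h1 := hB₁ k ⟨by simpa using hk2, hk⟩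
      have h0 := (norm_nonneg _).trans h1
      gcongr
    · push Not at hk2
      refine le_trans ?_ (le_max_right _ _)
      have hz0 := norm_nonneg z
      have hk0 : 0 < ‖k‖ := by linarith
      have hkz : ‖k‖ / 2 ≤ ‖k - z‖ := by
        have := norm_sub_norm_le k z
        linarith
      have hkz0 : k ≠ z := by
        rintro rfl
        linarith
      have hk1 : ‖k‖ ≤ ‖k + 1‖ := by
        rw [← sq_le_sq₀ (norm_nonneg _) (norm_nonneg _), Complex.sq_norm, Complex.sq_norm,
          normSq_apply, normSq_apply]
        have := re_nonneg_of_mem_raySector hk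
        simp only [add_re, one_re, add_im, one_im, add_zero]
        nlinarith
      have e1 : ‖h k‖ * ‖k‖ ≤ 2 * C := by
        calc ‖h k‖ * ‖k‖ ≤ C * ‖k‖ * Real.exp (-‖k‖) * ‖k‖ := by
              gcongr
              exact hb k hk
          _ = C * (‖k‖ ^ 2 * Real.exp (-‖k‖)) := by ring
          _ ≤ C * 2 := by
              gcongr
              exact sq_mul_exp_neg_le hk0.le
          _ = 2 * C := by ring
      have e2 : ‖h z * ((z + 1) / (k + 1))‖ * ‖k‖ ≤ ‖h z‖ * ‖z + 1‖ := by
        rw [norm_mul, norm_div, mul_assoc]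
        gcongr
        rw [div_mul_eq_mul_div, div_le_iff₀ (hk0.trans_le hk1)]
        gcongr
      have e3 : ‖g k‖ * ‖k‖ ≤ 2 * C + ‖h z‖ * ‖z + 1‖ := by
        calc ‖g k‖ * ‖k‖ ≤ (‖h k‖ + ‖h z * ((z + 1) / (k + 1))‖) * ‖k‖ := by
              gcongr
              exact norm_sub_le _ _
          _ ≤ _ := by linarith
      rw [dslope_of_ne _ hkz0, slope_def_field, hgz, sub_zero, norm_div]
      have h2 : ‖g k‖ / ‖k - z‖ ≤ ‖g k‖ / (‖k‖ / 2) := by gcongr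
      calc ‖g k‖ / ‖k - z‖ * (1 + ‖k‖ ^ 2) ≤ ‖g k‖ / (‖k‖ / 2) * (2 * ‖k‖ ^ 2) := by
            gcongr
            nlinarith
        _ = 4 * (‖g k‖ * ‖k‖) := by
            field_simp
            ring
        _ ≤ _ := by gcongr
  obtain ⟨hi1, hi2, heq⟩ := integral_Ioi_eq_integral_ray hqd hB
  have hr := ray_ne_zero
  have sp1 : -z ∈ slitPlane := Or.inr (by simpa using hz')
  have sp2 : (1 : ℂ) ∈ slitPlane := one_mem_slitPlane
  have him : |z.im| < 2 / 3 * z.re := hz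
  have sp3 : -z / ray ∈ slitPlane := by
    right
    have h2 := (abs_lt.1 him).2
    simp only [ray, div_im, neg_im, neg_re, normSq_mk]
    norm_num
    intro h0
    linarith
  have sp4 : 1 / ray ∈ slitPlane := by
    left
    simp only [ray, one_div, inv_re, normSq_mk]
    norm_num
  obtain ⟨hl1, hL1⟩ := integral_Ioi_inv_sub_inv sp1 sp2
  obtain ⟨hl2, hL2⟩ := integral_Ioi_inv_sub_inv sp3 sp4
  have lz : ∀ t : ℝ, (t : ℂ) - z ≠ 0 := fun t h0 => by
    have := congrArg Complex.im h0
    simp at this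
    exact hz' this
  have l1 : ∀ t : ℝ, 0 < t → (t : ℂ) + 1 ≠ 0 := fun t ht => hne _ (by simp; linarith)
  have f1 : lineCauchy h z = (∫ t in Set.Ioi (0 : ℝ), dslope g z t) +
      h z * ∫ t in Set.Ioi (0 : ℝ), (((t : ℂ) + -z)⁻¹ - ((t : ℂ) + 1)⁻¹) := by
    rw [← integral_const_mul, ← integral_add hi1 (hl1.const_mul _)]
    refine setIntegral_congr_fun measurableSet_Ioi fun t (ht : 0 < t) => ?_
    have a1 := lz t
    have a2 := l1 t ht
    rw [hq _ (sub_ne_zero.1 a1), ← sub_eq_add_neg (t : ℂ) z]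
    field_simp
    ring
  have f2 : rayCauchy h z = (∫ t in Set.Ioi (0 : ℝ), ray * dslope g z (ray * t)) +
      h z * ∫ t in Set.Ioi (0 : ℝ), (((t : ℂ) + -z / ray)⁻¹ - ((t : ℂ) + 1 / ray)⁻¹) := by
    rw [← integral_const_mul, ← integral_add hi2 (hl2.const_mul _)]
    refine setIntegral_congr_fun measurableSet_Ioi fun t (ht : 0 < t) => ?_
    have a1 := ray_mul_sub_ne_zero hz t
    have a2 := hne _ (hsub _ (ray_mul_mem_raySector ht.le))
    rw [hq _ (sub_ne_zero.1 a1)]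
    have b1 : ((t : ℂ) + -z / ray)⁻¹ = ray / (ray * t - z) := by
      rw [show (t : ℂ) + -z / ray = (ray * t - z) / ray by field_simp; ring, inv_div]
    have b2 : ((t : ℂ) + 1 / ray)⁻¹ = ray / (ray * t + 1) := by
      rw [show (t : ℂ) + 1 / ray = (ray * t + 1) / ray by field_simp, inv_div]
    rw [b1, b2]
    field_simp
    ring
  rw [f1, f2, heq, hL1, hL2, log_one]
  ring

lemma log_neg_of_im_pos {z : ℂ} (hz : 0 < z.im) : log (-z) = log z - Real.pi * I := by
  rw [log, log, norm_neg, arg_neg_eq_arg_sub_pi_of_im_pos hz]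
  push_cast
  ring

lemma log_neg_of_im_neg {z : ℂ} (hz : z.im < 0) : log (-z) = log z + Real.pi * I := by
  rw [log, log, norm_neg, arg_neg_eq_arg_add_pi_of_im_neg hz]
  push_cast
  ring

/-- Both `z` and `1 / ray` lie in the right half-plane, so their arguments add without wrapping.
Since `z` lies below the ray, `z / ray` is in the lower half-plane whatever the sign of `Im z`. By
contrast `log (-z)` depends on that sign, and this is the source of the `2πi`. -/
lemma log_neg_div_ray {z : ℂ} (hz : z ∈ openSector) :
    log (-z / ray) = log z + log (1 / ray) + Real.pi * I := by
  have hre := re_pos_of_mem_openSector hz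
  have him : |z.im| < 2 / 3 * z.re := hz
  have h2 := (abs_lt.1 him).2
  have hz0 : z ≠ 0 := by
    rintro rfl
    simp at hre
  have hr0 : 1 / ray ≠ 0 := one_div_ne_zero ray_ne_zero
  have hrre : 0 < (1 / ray).re := by
    simp only [ray, one_div, inv_re, normSq_mk]
    norm_num
  rw [show -z / ray = -(z * (1 / ray)) by ring, log_neg_of_im_neg,
    log_mul_eq_add_log_iff hz0 hr0 |>.2]
  · have a1 := abs_lt.1 (abs_arg_lt_pi_div_two_iff.2 (Or.inl hre))
    have a2 := abs_lt.1 (abs_arg_lt_pi_div_two_iff.2 (Or.inl hrre))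
    constructor <;> linarith
  · simp only [ray, one_div, mul_im, inv_re, inv_im, normSq_mk]
    norm_num
    linarith

/-- Below the real axis no pole is crossed. -/
theorem lineCauchy_eq_of_im_neg (hh : Differentiable ℂ h)
    (hb : ∀ k ∈ raySector, ‖h k‖ ≤ C * ‖k‖ * Real.exp (-‖k‖)) {z : ℂ} (hz : z ∈ openSector)
    (hz' : z.im < 0) : lineCauchy h z = rayCauchy h z := by
  have := lineCauchy_sub_rayCauchy hh hb hz hz'.ne
  rw [log_neg_div_ray hz, log_neg_of_im_neg hz'] at this
  rw [← sub_eq_zero, this]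
  ring

/-- Above the real axis the pole at `z` is crossed. -/
theorem lineCauchy_eq_of_im_pos (hh : Differentiable ℂ h)
    (hb : ∀ k ∈ raySector, ‖h k‖ ≤ C * ‖k‖ * Real.exp (-‖k‖)) {z : ℂ} (hz : z ∈ openSector)
    (hz' : 0 < z.im) : lineCauchy h z = rayCauchy h z + 2 * Real.pi * I * h z := by
  have := lineCauchy_sub_rayCauchy hh hb hz hz'.ne'
  rw [log_neg_div_ray hz, log_neg_of_im_pos hz'] at this
  rw [← sub_eq_iff_eq_add', this]
  ring

end

/-! ### The Fourier transform of the unit sphere -/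

open Metric in
/-- Integration in polar coordinates of a product of an angular and a radial function. -/
theorem integral_mul_norm_eq_toSphere {E : Type*} [NormedAddCommGroup E] [NormedSpace ℝ E]
    [MeasurableSpace E] [Nontrivial E] (μ : Measure E) [FiniteDimensional ℝ E] [BorelSpace E]
    [μ.IsAddHaarMeasure] (u : E → ℝ) (a : sphere (0 : E) 1 → ℝ) (b : ℝ → ℝ)
    (hu : ∀ (ω : sphere (0 : E) 1) (r : ℝ), 0 < r → u (r • (ω : E)) = a ω * b r) :
    ∫ p, u p ∂μ =
      (∫ ω, a ω ∂μ.toSphere) *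
        ∫ r in Set.Ioi (0 : ℝ), r ^ (Module.finrank ℝ E - 1) * b r :=
  calc
    ∫ p, u p ∂μ = ∫ p : ({(0)}ᶜ : Set E), u p ∂(μ.comap (↑)) := by
      rw [integral_subtype_comap (measurableSet_singleton _).compl u, restrict_compl_singleton]
    _ = ∫ q : sphere (0 : E) 1 × Set.Ioi (0 : ℝ), a q.1 * b q.2
          ∂μ.toSphere.prod (.volumeIoiPow (Module.finrank ℝ E - 1)) := by
      rw [← μ.measurePreserving_homeomorphUnitSphereProd.integral_comp
        (Homeomorph.measurableEmbedding _)]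
      refine integral_congr_ae (.of_forall fun p => ?_)
      have hp : (p : E) ≠ 0 := p.2
      have h0 : 0 < ‖(p : E)‖ := norm_pos_iff.2 hp
      have := hu (homeomorphUnitSphereProd E p).1 ‖(p : E)‖ h0
      simp only [homeomorphUnitSphereProd_apply_fst_coe, smul_inv_smul₀ h0.ne'] at this
      simp only [homeomorphUnitSphereProd_apply_snd_coe]
      exact this
    _ = (∫ ω, a ω ∂μ.toSphere) *
          ∫ r : Set.Ioi (0 : ℝ), b r ∂.volumeIoiPow (Module.finrank ℝ E - 1) :=
      integral_prod_mul a (fun r : Set.Ioi (0 : ℝ) => b r)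
    _ = _ := by
      congr 1
      simp only [Measure.volumeIoiPow, ENNReal.ofReal]
      rw [integral_withDensity_eq_integral_smul,
        integral_subtype_comap measurableSet_Ioi
          fun r : ℝ ↦ Real.toNNReal (r ^ (Module.finrank ℝ E - 1)) • b r,
        setIntegral_congr_fun measurableSet_Ioi fun r hr ↦ ?_]
      · rw [NNReal.smul_def, Real.coe_toNNReal _ (pow_nonneg hr.out.le _), smul_eq_mul]
      · exact (measurable_subtype_coe.pow_const _).real_toNNReal

lemma integral_pow_mul_exp_neg_sq_Ioi (n : ℕ) :
    ∫ t in Set.Ioi (0 : ℝ), t ^ n * Real.exp (-t ^ 2) = 1 / 2 * Real.Gamma ((n + 1) / 2) := by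
  have := integral_rpow_mul_exp_neg_rpow (p := 2) (q := n) two_pos (by
    have : (0 : ℝ) ≤ n := n.cast_nonneg
    linarith)
  rw [← this]
  refine setIntegral_congr_fun measurableSet_Ioi fun t _ => ?_
  simp

lemma integrable_pow_mul_exp_neg_sq (n : ℕ) :
    Integrable fun t : ℝ => t ^ n * Real.exp (-t ^ 2) := by
  have := integrable_rpow_mul_exp_neg_mul_sq one_pos (s := n) (by
    have : (0 : ℝ) ≤ n := n.cast_nonneg
    linarith)
  simpa using this

lemma integral_pow_mul_exp_neg_sq (n : ℕ) :
    ∫ t : ℝ, t ^ n * Real.exp (-t ^ 2) =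
      (1 + (-1) ^ n) * (1 / 2 * Real.Gamma ((n + 1) / 2)) := by
  have hi := integrable_pow_mul_exp_neg_sq n
  rw [← intervalIntegral.integral_Iic_add_Ioi (b := 0) hi.integrableOn hi.integrableOn,
    ← integral_pow_mul_exp_neg_sq_Ioi]
  have := integral_comp_neg_Iic 0 (fun t : ℝ => (-1) ^ n * (t ^ n * Real.exp (-t ^ 2)))
  rw [neg_zero] at this
  rw [one_add_mul, ← integral_const_mul, ← this, add_comm]
  congr 1
  refine setIntegral_congr_fun measurableSet_Iic fun t _ => ?_
  simp only [even_two, Even.neg_pow]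
  rw [neg_pow t n, ← mul_assoc, ← mul_assoc, ← mul_pow]
  norm_num

local notation "E3" => EuclideanSpace ℝ (Fin 3)

lemma exists_orthonormalBasis_eq_norm_smul (x : E3) :
    ∃ b : OrthonormalBasis (Fin 3) ℝ E3, x = ‖x‖ • b 0 := by
  by_cases hx : x = 0
  · exact ⟨EuclideanSpace.basisFun (Fin 3) ℝ, by simp [hx]⟩
  · have hx' : ‖x‖ ≠ 0 := norm_ne_zero_iff.2 hx
    obtain ⟨b, hb⟩ := Orthonormal.exists_orthonormalBasis_extension_of_card_eq
      (𝕜 := ℝ) (E := E3) (ι := Fin 3) (by simp) (v := fun _ => ‖x‖⁻¹ • x) (s := {0}) (by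
        constructor
        · intro i
          simp [norm_smul, hx']
        · intro i j hij
          exact absurd (Subsingleton.elim i j) hij)
    refine ⟨b, ?_⟩
    rw [hb 0 rfl, smul_inv_smul₀ hx']

/-- In an orthonormal basis whose first vector points along `x`, the integrand factors into three
one-dimensional Gaussian integrals. Comparison with polar coordinates then yields the spherical
moments. -/
lemma integral_inner_pow_mul_exp_neg_sq (x : E3) (n : ℕ) :
    ∫ p : E3, inner ℝ p x ^ n * Real.exp (-‖p‖ ^ 2) =
      ‖x‖ ^ n * ((1 + (-1) ^ n) * (1 / 2 * Real.Gamma ((n + 1) / 2))) * Real.pi := by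
  obtain ⟨b, hb⟩ := exists_orthonormalBasis_eq_norm_smul x
  rw [← b.measurePreserving_repr_symm.integral_comp
    b.repr.symm.toHomeomorph.measurableEmbedding]
  rw [← (PiLp.volume_preserving_toLp (Fin 3)).integral_comp
    (MeasurableEquiv.toLp 2 (Fin 3 → ℝ)).measurableEmbedding]
  have key : ∀ q : Fin 3 → ℝ, inner ℝ (b.repr.symm (WithLp.toLp 2 q)) x ^ n *
      Real.exp (-‖b.repr.symm (WithLp.toLp 2 q)‖ ^ 2) =
      ∏ i, (if i = 0 then fun t : ℝ => ‖x‖ ^ n * (t ^ n * Real.exp (-t ^ 2))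
        else fun t : ℝ => Real.exp (-t ^ 2)) (q i) := by
    intro q
    have h1 : inner ℝ (b.repr.symm (WithLp.toLp 2 q)) x = ‖x‖ * q 0 := by
      nth_rw 1 [hb]
      rw [inner_smul_right, real_inner_comm, ← b.repr_apply_apply, LinearIsometryEquiv.apply_symm_apply]
    have h2 : ‖b.repr.symm (WithLp.toLp 2 q)‖ ^ 2 = q 0 ^ 2 + q 1 ^ 2 + q 2 ^ 2 := by
      rw [LinearIsometryEquiv.norm_map, EuclideanSpace.norm_sq_eq, Fin.sum_univ_three]
      simp
    rw [h1, h2, Fin.prod_univ_three, mul_pow, neg_add, neg_add, Real.exp_add, Real.exp_add]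
    simp
    ring
  simp_rw [key]
  rw [integral_fintype_prod_volume_eq_prod, Fin.prod_univ_three]
  have hg : ∫ t : ℝ, Real.exp (-t ^ 2) = √Real.pi := by
    simpa using integral_gaussian 1
  simp only [Fin.isValue, one_ne_zero, if_true, if_false, Fin.reduceEq]
  rw [integral_const_mul, integral_pow_mul_exp_neg_sq, hg, mul_assoc (_ * _) (√Real.pi),
    Real.mul_self_sqrt Real.pi_pos.le]

/-- The moments of the surface measure of the unit sphere of `ℝ³`. -/
theorem integral_inner_pow_toSphere (x : E3) (n : ℕ) :
    ∫ ω : Metric.sphere (0 : E3) 1, inner ℝ (ω : E3) x ^ n ∂(volume : Measure E3).toSphere =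
      2 * Real.pi * ‖x‖ ^ n * (1 + (-1) ^ n) / (n + 1) := by
  have h1 := integral_inner_pow_mul_exp_neg_sq x n
  rw [integral_mul_norm_eq_toSphere volume _ (fun ω => inner ℝ (ω : E3) x ^ n)
    (fun r => r ^ n * Real.exp (-r ^ 2)) (fun ω r hr => by
      rw [inner_smul_left, norm_smul, mul_pow]
      simp
      ring)] at h1
  -- Written with `Γ(s + 1) = s Γ(s)`, so that the Gamma factor cancels against the Cartesian
  -- computation and leaves `1/(n + 1)`.
  have h2 : ∫ r in Set.Ioi (0 : ℝ), r ^ (Module.finrank ℝ E3 - 1) * (r ^ n * Real.exp (-r ^ 2)) =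
      1 / 2 * ((n + 1) / 2 * Real.Gamma ((n + 1) / 2)) := by
    rw [← Real.Gamma_add_one (by positivity),
      show ((n : ℝ) + 1) / 2 + 1 = (((n + 2 : ℕ) : ℝ) + 1) / 2 by push_cast; ring,
      ← integral_pow_mul_exp_neg_sq_Ioi]
    refine setIntegral_congr_fun measurableSet_Ioi fun t _ => ?_
    simp only [finrank_euclideanSpace, Fintype.card_fin]
    ring
  rw [h2] at h1
  have hG : 0 < Real.Gamma (((n : ℝ) + 1) / 2) := Real.Gamma_pos_of_pos (by positivity)
  have hn : (0 : ℝ) < n + 1 := by positivity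
  rw [eq_div_iff hn.ne']
  refine mul_right_cancel₀ hG.ne' ?_
  linear_combination 4 * h1

/-- The Fourier transform of the surface measure of the unit sphere of `ℝ³`. -/
theorem integral_cexp_inner_toSphere (x : E3) :
    I * ‖x‖ * ∫ ω : Metric.sphere (0 : E3) 1, cexp (I * (inner ℝ (ω : E3) x : ℝ))
      ∂(volume : Measure E3).toSphere = 4 * Real.pi * I * Complex.sin ‖x‖ := by
  set σ := (volume : Measure E3).toSphere
  have hexp0 : ∀ w : ℂ, HasSum (fun n : ℕ => w ^ n / (n.factorial : ℂ)) (cexp w) := by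
    intro w
    have h := NormedSpace.exp_series_hasSum_exp' (𝕂 := ℂ) w
    rw [← Complex.exp_eq_exp_ℂ] at h
    simpa [div_eq_inv_mul] using h
  have hsum : HasSum (fun n : ℕ => ∫ ω : Metric.sphere (0 : E3) 1,
      (I * (inner ℝ (ω : E3) x : ℝ)) ^ n / (n.factorial : ℂ) ∂σ)
      (∫ ω : Metric.sphere (0 : E3) 1, cexp (I * (inner ℝ (ω : E3) x : ℝ)) ∂σ) := by
    refine hasSum_integral_of_dominated_convergence (fun n _ => ‖x‖ ^ n / n.factorial)
      (fun n => ?_) (fun n => .of_forall fun ω => ?_) (.of_forall fun _ => ?_)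
      (integrable_const _) (.of_forall fun ω => ?_)
    · refine Continuous.aestronglyMeasurable ?_
      fun_prop
    · have h : |inner ℝ (ω : E3) x| ≤ ‖x‖ := by
        have h1 := abs_real_inner_le_norm (ω : E3) x
        have h2 : ‖(ω : E3)‖ = 1 := by simp
        rwa [h2, one_mul] at h1
      rw [norm_div, norm_pow, norm_mul, norm_I, one_mul, norm_real, Real.norm_eq_abs, norm_natCast]
      gcongr
    · exact Real.summable_pow_div_factorial _
    · exact hexp0 _
  -- The factor `I * ‖x‖` supplies the missing power, turning `n! (n + 1)` into `(n + 1)!`. Then `1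
  -- + (-1)^n` splits the series into those of `exp(i‖x‖)` and `exp(-i‖x‖)`.
  have hterm : ∀ n : ℕ, I * ‖x‖ * ∫ ω : Metric.sphere (0 : E3) 1,
      (I * (inner ℝ (ω : E3) x : ℝ)) ^ n / (n.factorial : ℂ) ∂σ =
      2 * Real.pi * ((‖x‖ * I) ^ (n + 1) / ((n + 1).factorial : ℂ) -
        (-‖x‖ * I) ^ (n + 1) / ((n + 1).factorial : ℂ)) := by
    intro n
    have h1 : ∀ ω : Metric.sphere (0 : E3) 1,
        (I * (inner ℝ (ω : E3) x : ℝ)) ^ n / (n.factorial : ℂ) =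
        I ^ n / (n.factorial : ℂ) * ((inner ℝ (ω : E3) x ^ n : ℝ) : ℂ) := fun ω => by
      push_cast
      ring
    simp_rw [h1]
    rw [integral_const_mul, integral_complex_ofReal, integral_inner_pow_toSphere]
    have hf : (n.factorial : ℂ) ≠ 0 := by exact_mod_cast n.factorial_ne_zero
    have hn : (n : ℂ) + 1 ≠ 0 := by exact_mod_cast n.succ_ne_zero
    rw [Nat.factorial_succ]
    push_cast
    rw [neg_mul, neg_pow (‖x‖ * I : ℂ), mul_pow]
    field_simp
    ring
  have hexp : ∀ w : ℂ, HasSum (fun n : ℕ => w ^ (n + 1) / ((n + 1).factorial : ℂ)) (cexp w - 1) := by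
    intro w
    simpa using (hasSum_nat_add_iff' 1).2 (hexp0 w)
  have h1 := hsum.mul_left (I * ‖x‖)
  simp_rw [hterm] at h1
  have h2 := ((hexp (‖x‖ * I)).sub (hexp (-‖x‖ * I))).mul_left (2 * Real.pi : ℂ)
  rw [h1.unique h2, Complex.sin]
  ring_nf
  rw [I_sq]
  ring

theorem f_eq_integral_toSphere (k : ℝ) (x : E3) :
    f k ‖x‖ = ∫ ω : Metric.sphere (0 : E3) 1, cexp (I * (k * (inner ℝ (ω : E3) x : ℝ)))
      ∂(volume : Measure E3).toSphere := by
  have key := integral_cexp_inner_toSphere (k • x)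
  simp only [inner_smul_right, norm_smul, ofReal_mul, Real.norm_eq_abs] at key
  unfold f
  split_ifs with h
  · have h0 := integral_inner_pow_toSphere (k • x) 0
    simp only [pow_zero, integral_const, smul_eq_mul, mul_one] at h0
    have h1 : k • x = 0 := by
      rcases mul_eq_zero.1 h with h | h
      · simp [ofReal_eq_zero.1 h]
      · simp [norm_eq_zero.1 (ofReal_eq_zero.1 h)]
    have h2 : ∀ ω : Metric.sphere (0 : E3) 1, (k : ℂ) * (inner ℝ (ω : E3) x : ℝ) = 0 := fun ω => by
      rw [← ofReal_mul, ← inner_smul_right, h1, inner_zero_right, ofReal_zero]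
    simp_rw [h2]
    simp only [mul_zero, Complex.exp_zero, integral_const, h0]
    norm_num
    ring
  · have h' : (k : ℂ) * ‖x‖ ≠ 0 := h
    have hI := I_ne_zero
    rcases le_total 0 k with hk | hk
    · rw [abs_of_nonneg hk] at key
      rw [div_eq_iff h]
      refine mul_left_cancel₀ hI ?_
      linear_combination -key
    · rw [abs_of_nonpos hk] at key
      rw [div_eq_iff h]
      refine mul_left_cancel₀ hI ?_
      push_cast at key
      rw [neg_mul, Complex.sin_neg] at key
      linear_combination key

/-! ### Independence of plane waves and positive definiteness -/

lemma eq_zero_of_forall_ofReal {F : ℂ → ℂ} (hF : Differentiable ℂ F) (h0 : ∀ t : ℝ, F t = 0)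
    (z : ℂ) : F z = 0 := by
  have hF' : AnalyticOnNhd ℂ F Set.univ := fun w _ => hF.analyticAt w
  have hfreq : ∃ᶠ w in 𝓝[≠] (0 : ℂ), F w = 0 := by
    have ht : Tendsto (fun t : ℝ => (t : ℂ)) (𝓝[≠] 0) (𝓝[≠] 0) := by
      refine tendsto_nhdsWithin_of_tendsto_nhds_of_eventually_within _
        ((continuous_ofReal.tendsto' 0 0 (by simp)).mono_left nhdsWithin_le_nhds) ?_
      filter_upwards [self_mem_nhdsWithin] with t ht
      simpa using ht
    exact ht.frequently (Eventually.of_forall h0).frequently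
  exact hF'.eqOn_zero_of_preconnected_of_frequently_eq_zero isPreconnected_univ
    (Set.mem_univ 0) hfreq (Set.mem_univ z)

/-- Plane waves at distinct points are linearly independent on the unit sphere. -/
theorem eq_zero_of_sum_cexp_sphere_eq_zero {N : ℕ} {x : Fin N → E3} (hx : Function.Injective x)
    {k : ℝ} (hk : 0 < k) {v : Fin N → ℂ}
    (hv : ∀ ω : E3, ‖ω‖ = 1 → ∑ l, v l * cexp (I * (k * (inner ℝ ω (x l) : ℝ))) = 0) :
    v = 0 := by
  classical
  by_contra hne
  set s := Finset.univ.filter fun l => v l ≠ 0 with hs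
  have hsne : s.Nonempty := by
    obtain ⟨l, hl⟩ := Function.ne_iff.1 hne
    exact ⟨l, by simpa [hs] using hl⟩
  -- A point of largest norm in the support is the unique maximiser there of the linear functional
  -- in its own direction, by the equality case of Cauchy–Schwarz. Its exponential will dominate all
  -- others.
  obtain ⟨m, hm, hmax⟩ := s.exists_max_image (fun l => ‖x l‖) hsne
  have hvm : v m ≠ 0 := by simpa [hs] using hm
  obtain ⟨b, hb⟩ := exists_orthonormalBasis_eq_norm_smul (x m)
  have hb1 : ∀ i, ‖b i‖ = 1 := b.norm_eq_one
  have hlt : ∀ l, l ≠ m → v l ≠ 0 → inner ℝ (b 0) (x l) < ‖x m‖ := by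
    intro l hl hvl
    have h1 : inner ℝ (b 0) (x l) ≤ ‖x l‖ := by
      simpa [hb1] using real_inner_le_norm (b 0) (x l)
    have h2 : ‖x l‖ ≤ ‖x m‖ := hmax l (by simpa [hs] using hvl)
    refine lt_of_le_of_ne (h1.trans h2) fun h3 => hl (hx ?_)
    have h4 : ‖x l‖ = ‖x m‖ := le_antisymm h2 (h3 ▸ h1)
    have h5 : inner ℝ (b 0) (x l) = ‖b 0‖ * ‖x l‖ := by rw [h3, hb1, one_mul, h4]
    have h6 := (inner_eq_norm_mul_iff_real).1 h5
    rw [hb1, one_smul] at h6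
    rw [← h6, h4, ← hb]
  have hbm : inner ℝ (b 0) (x m) = ‖x m‖ := by
    nth_rw 1 [hb]
    rw [inner_smul_right, real_inner_self_eq_norm_sq, hb1]
    simp
  -- On a great circle through `b 0` the relation is entire in the angle, so it extends to complex
  -- angles. There the plane waves grow exponentially.
  have hcirc : ∀ θ : ℂ, ∑ l, v l * cexp (I * (k * (Complex.cos θ * (inner ℝ (b 1) (x l) : ℝ) +
      Complex.sin θ * (inner ℝ (b 0) (x l) : ℝ)))) = 0 := by
    refine eq_zero_of_forall_ofReal (by fun_prop) fun t => ?_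
    have hn : ‖Real.cos t • b 1 + Real.sin t • b 0‖ = 1 := by
      have h01 : inner ℝ (b 1) (b 0) = 0 := b.orthonormal.2 (by decide)
      rw [← sq_eq_sq₀ (norm_nonneg _) zero_le_one, norm_add_sq_real, inner_smul_left,
        inner_smul_right, h01, norm_smul, norm_smul, hb1, hb1]
      simp
    have := hv _ hn
    simp only [inner_add_left, inner_smul_left] at this
    push_cast at this
    simpa using this
  have hbound : ∀ τ : ℝ, ‖v m‖ ≤ ∑ l ∈ Finset.univ.erase m,
      ‖v l‖ * Real.exp (-(τ * (‖x m‖ - inner ℝ (b 0) (x l)))) := by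
    intro τ
    -- At `θ = -iρ` with `k sinh ρ = τ`, the `l`-th wave has modulus `exp(τ ⟨b 0, x l⟩)`; the `cosh`
    -- term is a pure phase.
    set ρ := Real.arsinh (τ / k) with hρ
    have hsin : Real.sinh ρ = τ / k := Real.sinh_arsinh _
    have hnorm : ∀ l, ‖cexp (I * (k * (Complex.cos (-(ρ * I)) * (inner ℝ (b 1) (x l) : ℝ) +
        Complex.sin (-(ρ * I)) * (inner ℝ (b 0) (x l) : ℝ))))‖ =
        Real.exp (τ * inner ℝ (b 0) (x l)) := by
      intro l
      rw [Complex.cos_neg, Complex.sin_neg, Complex.cos_mul_I, Complex.sin_mul_I,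
        ← ofReal_cosh, ← ofReal_sinh, hsin, norm_exp]
      congr 1
      have : I * (k * (((Real.cosh ρ : ℝ) : ℂ) * (inner ℝ (b 1) (x l) : ℝ) +
          -(((τ / k : ℝ) : ℂ) * I) * (inner ℝ (b 0) (x l) : ℝ))) =
          ((τ * inner ℝ (b 0) (x l) : ℝ) : ℂ) +
          ((k * Real.cosh ρ * inner ℝ (b 1) (x l) : ℝ) : ℂ) * I := by
        have hk' : (k : ℂ) ≠ 0 := by exact_mod_cast hk.ne'
        push_cast
        field_simp
        ring_nf
        rw [I_sq]
        ring
      rw [this]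
      simp
    have h0 := hcirc (-(ρ * I))
    rw [← Finset.add_sum_erase _ _ (Finset.mem_univ m), add_eq_zero_iff_eq_neg] at h0
    have h1 := congrArg norm h0
    rw [norm_neg, norm_mul, hnorm, hbm] at h1
    have h2 : ‖v m‖ * Real.exp (τ * ‖x m‖) ≤ ∑ l ∈ Finset.univ.erase m,
        ‖v l‖ * Real.exp (τ * inner ℝ (b 0) (x l)) := by
      rw [h1]
      refine (norm_sum_le _ _).trans_eq (Finset.sum_congr rfl fun l _ => ?_)
      rw [norm_mul, hnorm]
    rw [← le_div_iff₀ (Real.exp_pos _), Finset.sum_div] at h2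
    refine h2.trans_eq (Finset.sum_congr rfl fun l _ => ?_)
    rw [mul_div_assoc, ← Real.exp_sub]
    ring_nf
  have hlim : Tendsto (fun τ : ℝ => ∑ l ∈ Finset.univ.erase m,
      ‖v l‖ * Real.exp (-(τ * (‖x m‖ - inner ℝ (b 0) (x l))))) atTop (𝓝 0) := by
    have hz : ∑ _l ∈ Finset.univ.erase m, (0 : ℝ) = 0 := Finset.sum_const_zero
    refine hz ▸ tendsto_finsetSum _ fun l hl => ?_
    by_cases hvl : v l = 0
    · simp [hvl]
    · have hpos := sub_pos.2 (hlt l (Finset.ne_of_mem_erase hl) hvl)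
      have := (Real.tendsto_exp_neg_atTop_nhds_zero.comp
        (tendsto_id.atTop_mul_const hpos)).const_mul ‖v l‖
      simpa using this
  have := ge_of_tendsto' hlim hbound
  exact hvm (norm_le_zero_iff.1 this)

/-- The kernel `f(k, |x_j - x_ℓ|)` is strictly positive definite for distinct points. -/
theorem re_sum_f_dist_pos {N : ℕ} {x : Fin N → E3} (hx : Function.Injective x)
    {k : ℝ} (hk : 0 < k) {v : Fin N → ℂ} (hv : v ≠ 0) :
    0 < (∑ j, ∑ l, (starRingEnd ℂ) (v j) * f k (dist (x j) (x l)) * v l).re := by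
  set σ := (volume : Measure E3).toSphere
  set u : Metric.sphere (0 : E3) 1 → ℂ := fun ω =>
    ∑ l, v l * cexp (I * (k * (inner ℝ (ω : E3) (x l) : ℝ))) with hu
  have hucont : Continuous u := by fun_prop
  obtain ⟨ω₀, hω₀⟩ : ∃ ω₀, u ω₀ ≠ 0 := by
    by_contra! h
    exact hv (eq_zero_of_sum_cexp_sphere_eq_zero hx hk fun ω hω => h ⟨ω, by simpa using hω⟩)
  have hpos : 0 < ∫ ω, normSq (u ω) ∂σ :=
    Continuous.integral_pos_of_hasCompactSupport_nonneg_nonzero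
      (continuous_normSq.comp hucont) (HasCompactSupport.of_compactSpace _)
      (fun ω => normSq_nonneg _) (x := ω₀) (by simpa using hω₀)
  have hint : ∀ (c : ℂ) (y : E3), Integrable (fun ω : Metric.sphere (0 : E3) 1 =>
      c * cexp (I * (k * (inner ℝ (ω : E3) y : ℝ)))) σ := fun c y =>
    (Continuous.integrable_of_hasCompactSupport (by fun_prop)
      (HasCompactSupport.of_compactSpace _))
  -- Expanding `|u|²` gives the phases `exp(ik ω·(x l - x j))`, whose spherical integrals are the
  -- kernel entries.
  have heq : ∑ j, ∑ l, (starRingEnd ℂ) (v j) * f k (dist (x j) (x l)) * v l =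
      ((∫ ω, normSq (u ω) ∂σ : ℝ) : ℂ) := by
    have h1 : ∀ ω, ((normSq (u ω) : ℝ) : ℂ) = ∑ j, ∑ l, (starRingEnd ℂ) (v j) * v l *
        cexp (I * (k * (inner ℝ (ω : E3) (x l - x j) : ℝ))) := by
      intro ω
      rw [← mul_conj, mul_comm, hu, map_sum, Finset.sum_mul_sum]
      refine Finset.sum_congr rfl fun j _ => Finset.sum_congr rfl fun l _ => ?_
      rw [map_mul, ← exp_conj, mul_mul_mul_comm, ← Complex.exp_add, inner_sub_right]
      simp only [map_mul, conj_I, conj_ofReal]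
      push_cast
      ring_nf
    rw [← integral_complex_ofReal]
    simp_rw [h1]
    rw [integral_finsetSum _ fun j _ => integrable_finsetSum _ fun l _ => hint _ _]
    refine Finset.sum_congr rfl fun j _ => ?_
    rw [integral_finsetSum _ fun l _ => hint _ _]
    refine Finset.sum_congr rfl fun l _ => ?_
    rw [integral_const_mul, dist_comm, dist_eq_norm, f_eq_integral_toSphere]
    ring
  rw [heq, ofReal_re]
  exact hpos

/-! ### Counting zeros with multiplicity, and conjugation -/

lemma exists_fin_fun_of_multiset_card {α : Type*} [DecidableEq α] {N : ℕ} (s : Multiset α)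
    (hs : s.card = N) :
    ∃ y : Fin N → α, ∀ z, (Finset.univ.filter fun j => y j = z).card = s.count z := by
  subst hs
  induction s using Quotient.inductionOn with
  | h l =>
    refine ⟨l.get, fun z => ?_⟩
    have : ((l : Multiset α)).count z = (Multiset.map l.get Finset.univ.val).count z := by
      rw [Fin.univ_val_map, List.ofFn_get]
    rw [Finset.card_def, Finset.filter_val]
    refine Eq.trans ?_ this.symm
    rw [Multiset.count_map]
    congr 2
    ext i
    exact eq_comm

open Metric in
/-- A form of Rouché's theorem: if `F(z)/(z - c)^N` stays within distance one of `1` on a circle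
around `c`, then `F` has exactly `N` zeros in the disk, counted with multiplicity. -/
theorem exists_roots_in_ball {F : ℂ → ℂ} {c : ℂ} {r : ℝ} (hr : 0 < r) {N : ℕ}
    (hF : AnalyticOnNhd ℂ F (closedBall c r))
    (hb : ∀ z ∈ sphere c r, ‖F z / (z - c) ^ N - 1‖ < 1) :
    ∃ y : Fin N → ℂ, (∀ j, y j ∈ ball c r) ∧ ∀ z ∈ closedBall c r,
      analyticOrderAt F z = ((Finset.univ.filter fun j => y j = z).card : ℕ∞) := by
  classical
  have hpow : ∀ z ∈ sphere c r, (z - c) ^ N ≠ 0 := fun z hz =>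
    pow_ne_zero _ (sub_ne_zero.2 (ne_of_mem_sphere hz hr.ne'))
  have hslit : ∀ z ∈ sphere c r, F z / (z - c) ^ N ∈ slitPlane := fun z hz => by
    simpa using mem_slitPlane_of_norm_lt_one (hb z hz)
  have hFs : ∀ z ∈ sphere c r, F z ≠ 0 := fun z hz h0 => by
    have := slitPlane_ne_zero (hslit z hz)
    simp [h0] at this
  obtain ⟨z₁, hz₁⟩ := (NormedSpace.sphere_nonempty (E := ℂ) (x := c)).2 hr.le
  have hpre : IsPreconnected (closedBall c r) := (convex_closedBall c r).isPreconnected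
  have htop : ∀ z ∈ closedBall c r, analyticOrderAt F z ≠ ⊤ := fun z hz =>
    hF.analyticOrderAt_ne_top_of_isPreconnected hpre (sphere_subset_closedBall hz₁) hz (by
      rw [(hF _ (sphere_subset_closedBall hz₁)).analyticOrderAt_eq_zero.2 (hFs _ hz₁)]
      exact ENat.zero_ne_top)
  have hmer : MeromorphicOn F (closedBall c r) := hF.meromorphicOn
  set D := MeromorphicOn.divisor F (closedBall c r) with hD
  have hDval : ∀ z ∈ closedBall c r, D z = (analyticOrderNatAt F z : ℤ) := fun z hz => by
    rw [hD, MeromorphicOn.divisor_apply hmer hz, (hF z hz).meromorphicOrderAt_eq,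
      ← Nat.cast_analyticOrderNatAt (htop z hz)]
    rfl
  have hDfin : D.support.Finite := D.finiteSupport (isCompact_closedBall c r)
  obtain ⟨g, hg, hg0, hFg⟩ := hmer.extract_zeros_poles (fun u => by
    rw [(hF u u.2).meromorphicOrderAt_eq, ← Nat.cast_analyticOrderNatAt (htop u u.2)]
    exact WithTop.coe_ne_top) hDfin
  set Z := hDfin.toFinset with hZ
  have hZball : ∀ u ∈ Z, u ∈ ball c r := by
    intro u hu
    have hu' : D u ≠ 0 := by simpa [hZ] using hu
    have huc : u ∈ closedBall c r := D.supportWithinDomain hu'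
    by_contra h
    have hus : u ∈ sphere c r := by
      rw [mem_sphere]
      exact le_antisymm huc (not_lt.1 h)
    apply hu'
    rw [hDval u huc]
    have := (hF u huc).analyticOrderAt_eq_zero.2 (hFs u hus)
    simp [analyticOrderNatAt, this]
  have hprod : (∏ᶠ u, (fun z : ℂ => z - u) ^ D u) =
      fun z => ∏ u ∈ Z, (z - u) ^ analyticOrderNatAt F u := by
    rw [finprod_eq_prod_of_mulSupport_subset (s := Z)]
    · ext z
      rw [Finset.prod_apply]
      refine Finset.prod_congr rfl fun u hu => ?_
      rw [hDval u (ball_subset_closedBall (hZball u hu)), zpow_natCast, Pi.pow_apply]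
    · intro u hu
      rw [Function.mem_mulSupport] at hu
      have : D u ≠ 0 := fun h => hu (by ext z; simp [h])
      simpa [hZ] using this
  rw [← hD, hprod] at hFg
  set P : ℂ → ℂ := fun z => ∏ u ∈ Z, (z - u) ^ analyticOrderNatAt F u with hP
  have hPd : Differentiable ℂ P := by
    intro z
    refine DifferentiableAt.fun_finsetProd fun u _ => ?_
    fun_prop
  -- The factorisation is so far known only off a discrete subset of the closed disk. Logarithmic
  -- derivatives on the circle need it on full neighbourhoods, which the identity principle
  -- provides.
  have hloc : ∀ z ∈ sphere c r, F =ᶠ[𝓝 z] P * g := by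
    intro z hz
    have hz' := sphere_subset_closedBall hz
    have hacc : AccPt z (𝓟 (closedBall c r)) := by
      have : z ∈ closure (ball c r) := by rwa [closure_ball _ hr.ne']
      have hzb : z ∉ ball c r := fun h => by
        rw [mem_sphere] at hz
        exact absurd (mem_ball.1 h) (by rw [hz]; exact lt_irrefl _)
      rw [accPt_principal_iff_nhdsWithin]
      have h2 : (𝓝[ball c r] z).NeBot := mem_closure_iff_nhdsWithin_neBot.1 this
      refine h2.mono (nhdsWithin_mono _ fun w hw => ⟨ball_subset_closedBall hw, ?_⟩)
      rintro rfl
      exact hzb hw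
    have hPa : AnalyticAt ℂ (P * g) z := (hPd.analyticAt z).mul (hg z hz')
    have := (hF z hz').meromorphicAt.eventuallyEq_nhdsNE_of_eventuallyEq_codiscreteWithin
      hPa.meromorphicAt hz' hacc hFg
    exact ((hF z hz').frequently_eq_iff_eventually_eq hPa).1 this.frequently
  -- The argument principle: the circle integral of `F'/F` is computed once from `F = P g` and once
  -- from `F = (z - c)^N · (F/(z - c)^N)`.
  have hsum : ∑ u ∈ Z, analyticOrderNatAt F u = N := by
    have hPs : ∀ z ∈ sphere c r, ∀ u ∈ Z, z - u ≠ 0 := by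
      intro z hz u hu h0
      rw [sub_eq_zero.1 h0] at hz
      exact absurd (mem_ball.1 (hZball u hu)) (by rw [mem_sphere.1 hz]; exact lt_irrefl _)
    have h1 : ∀ z ∈ sphere c r, logDeriv F z =
        ∑ u ∈ Z, (analyticOrderNatAt F u : ℂ) * (z - u)⁻¹ + logDeriv g z := by
      intro z hz
      have hz' := sphere_subset_closedBall hz
      have hP0 : P z ≠ 0 := Finset.prod_ne_zero_iff.2 fun u hu => pow_ne_zero _ (hPs z hz u hu)
      have e : logDeriv F z = logDeriv (fun w => P w * g w) z := by
        rw [logDeriv_apply, logDeriv_apply, (hloc z hz).deriv_eq, (hloc z hz).self_of_nhds]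
        rfl
      rw [e, logDeriv_mul z hP0 (hg0 ⟨z, hz'⟩) (hPd z) (hg z hz').differentiableAt, hP,
        logDeriv_prod (f := fun u w => (w - u) ^ analyticOrderNatAt F u)
          (fun u hu => pow_ne_zero _ (hPs z hz u hu)) (fun u _ => by fun_prop)]
      congr 1
      refine Finset.sum_congr rfl fun u hu => ?_
      rw [logDeriv_fun_pow (by fun_prop), logDeriv_apply]
      simp
    have h2 : ∀ z ∈ sphere c r, logDeriv F z =
        (N : ℂ) * (z - c)⁻¹ + logDeriv (fun w => F w / (w - c) ^ N) z := by
      intro z hz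
      have hd := (hF z (sphere_subset_closedBall hz)).differentiableAt
      rw [logDeriv_div z (hFs z hz) (hpow z hz) hd (by fun_prop), logDeriv_fun_pow (by fun_prop),
        logDeriv_apply (fun w => w - c)]
      simp
    -- Values within distance one of `1` lie in the slit plane, so the principal logarithm is a
    -- primitive along the circle.
    have c1 : ∮ z in C(c, r), logDeriv (fun w => F w / (w - c) ^ N) z = 0 := by
      refine circleIntegral.integral_eq_zero_of_hasDerivWithinAt hr.le
        (f := fun z => log (F z / (z - c) ^ N)) fun z hz => ?_
      have hd := (hF z (sphere_subset_closedBall hz)).differentiableAt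
      have : DifferentiableAt ℂ (fun w => F w / (w - c) ^ N) z :=
        hd.div (by fun_prop) (hpow z hz)
      exact (this.hasDerivAt.clog (hslit z hz)).hasDerivWithinAt
    have hgd : ∀ z ∈ closedBall c r, DifferentiableAt ℂ (logDeriv g) z := fun z hz =>
      ((hg z hz).deriv.div (hg z hz) (hg0 ⟨z, hz⟩)).differentiableAt
    have c2 : ∮ z in C(c, r), logDeriv g z = 0 :=
      circleIntegral_eq_zero_of_differentiable_on_off_countable hr.le Set.countable_empty
        (fun z hz => (hgd z hz).continuousAt.continuousWithinAt)
        (fun z hz => hgd z (ball_subset_closedBall hz.1))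
    have hinv : ∀ (a w : ℂ), w ∈ ball c r → CircleIntegrable (fun z => a * (z - w)⁻¹) c r := by
      intro a w hw
      refine ContinuousOn.circleIntegrable hr.le ?_
      refine continuousOn_const.mul (ContinuousOn.inv₀ (by fun_prop) fun z hz h0 => ?_)
      rw [sub_eq_zero.1 h0] at hz
      exact absurd (mem_ball.1 hw) (by rw [mem_sphere.1 hz]; exact lt_irrefl _)
    have c3 : ∮ z in C(c, r), logDeriv F z =
        ∑ u ∈ Z, (analyticOrderNatAt F u : ℂ) * (2 * Real.pi * I) := by
      rw [circleIntegral.integral_congr hr.le h1, circleIntegral.integral_add, c2, add_zero,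
        circleIntegral.integral_fun_sum]
      · refine Finset.sum_congr rfl fun u hu => ?_
        rw [circleIntegral.integral_const_mul,
          circleIntegral.integral_sub_inv_of_mem_ball (hZball u hu)]
      · exact fun u hu => hinv _ _ (hZball u hu)
      · exact CircleIntegrable.fun_sum _ fun u hu => hinv _ _ (hZball u hu)
      · exact ContinuousOn.circleIntegrable hr.le fun z hz =>
          (hgd z (sphere_subset_closedBall hz)).continuousAt.continuousWithinAt
    have c4 : ∮ z in C(c, r), logDeriv F z = (N : ℂ) * (2 * Real.pi * I) := by
      rw [circleIntegral.integral_congr hr.le h2, circleIntegral.integral_add, c1, add_zero,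
        circleIntegral.integral_const_mul,
        circleIntegral.integral_sub_inv_of_mem_ball (mem_ball_self hr)]
      · exact hinv _ _ (mem_ball_self hr)
      · refine ContinuousOn.circleIntegrable hr.le fun z hz => ?_
        have hA : AnalyticAt ℂ (fun w => F w / (w - c) ^ N) z :=
          (hF z (sphere_subset_closedBall hz)).div (by fun_prop) (hpow z hz)
        exact (hA.deriv.div hA (slitPlane_ne_zero (hslit z hz))).continuousAt.continuousWithinAt
    rw [c3, ← Finset.sum_mul] at c4
    have := mul_right_cancel₀ two_pi_I_ne_zero c4
    exact_mod_cast this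
  obtain ⟨y, hy⟩ := exists_fin_fun_of_multiset_card
    (∑ u ∈ Z, Multiset.replicate (analyticOrderNatAt F u) u) (by simpa using hsum)
  have hcount : ∀ z, Multiset.count z (∑ u ∈ Z, Multiset.replicate (analyticOrderNatAt F u) u) =
      if z ∈ Z then analyticOrderNatAt F z else 0 := by
    intro z
    rw [Multiset.count_sum']
    simp [Multiset.count_replicate]
  refine ⟨y, fun j => ?_, fun z hz => ?_⟩
  · have h1 := hy (y j)
    rw [hcount] at h1
    split_ifs at h1 with h
    · exact hZball _ h
    · rw [Finset.card_eq_zero] at h1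
      have : j ∈ Finset.univ.filter fun i => y i = y j := by simp
      rw [h1] at this
      simp at this
  · rw [hy z, hcount, ← Nat.cast_analyticOrderNatAt (htop z hz)]
    split_ifs with h
    · rfl
    · have : D z = 0 := by simpa [hZ] using h
      rw [hDval z hz] at this
      exact_mod_cast this

/-- The order of vanishing is invariant under complex conjugation. -/
theorem analyticOrderAt_conj_conj {F : ℂ → ℂ} {z : ℂ} (hF : AnalyticAt ℂ F z) {n : ℕ}
    (hn : analyticOrderAt F z = n) :
    AnalyticAt ℂ (fun w => (starRingEnd ℂ) (F ((starRingEnd ℂ) w))) ((starRingEnd ℂ) z) ∧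
    analyticOrderAt (fun w => (starRingEnd ℂ) (F ((starRingEnd ℂ) w))) ((starRingEnd ℂ) z) = n := by
  have hcont : Tendsto (starRingEnd ℂ) (𝓝 ((starRingEnd ℂ) z)) (𝓝 z) :=
    continuous_conj.tendsto' _ _ (conj_conj z)
  have hconj : ∀ {G : ℂ → ℂ}, AnalyticAt ℂ G z →
      AnalyticAt ℂ (fun w => (starRingEnd ℂ) (G ((starRingEnd ℂ) w))) ((starRingEnd ℂ) z) := by
    intro G hG
    rw [analyticAt_iff_eventually_differentiableAt] at hG ⊢
    filter_upwards [hcont.eventually hG] with w hw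
    simpa [Function.comp_def] using hw.conj_conj
  refine ⟨hconj hF, ?_⟩
  obtain ⟨g, hg, hg0, hFg⟩ := hF.analyticOrderAt_eq_natCast.1 hn
  refine (hconj hF).analyticOrderAt_eq_natCast.2 ⟨_, hconj hg, by simpa using hg0, ?_⟩
  filter_upwards [hcont.eventually hFg] with w hw
  rw [hw]
  simp

/-! ### The numerator and the boundary values of `A⁺` and `A⁻` -/

/-- The numerator `e^{-k²R²} k² f(k,r)` of the integral `Gam`, an entire function of `k`. -/
noncomputable def numer (R r : ℝ) (k : ℂ) : ℂ :=
  cexp (-(k ^ 2 * R ^ 2)) * (k ^ 2 * f k r)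

lemma sq_mul_f_zero (k : ℂ) : k ^ 2 * f k 0 = 4 * Real.pi * k ^ 2 := by
  simp [f]
  ring

lemma sq_mul_f_of_ne_zero {r : ℝ} (hr : r ≠ 0) (k : ℂ) :
    k ^ 2 * f k r = 4 * Real.pi / r * (k * Complex.sin (k * r)) := by
  have hr' : (r : ℂ) ≠ 0 := by exact_mod_cast hr
  by_cases hk : k = 0
  · simp [hk]
  · rw [f, if_neg (mul_ne_zero hk hr')]
    field_simp

lemma differentiable_numer (R r : ℝ) : Differentiable ℂ (numer R r) := by
  refine Differentiable.mul (by fun_prop) ?_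
  by_cases hr : r = 0
  · subst hr
    simp_rw [sq_mul_f_zero]
    fun_prop
  · simp_rw [sq_mul_f_of_ne_zero hr]
    fun_prop

lemma f_conj (k : ℂ) (r : ℝ) : f ((starRingEnd ℂ) k) r = (starRingEnd ℂ) (f k r) := by
  have h : (starRingEnd ℂ) k * (r : ℂ) = (starRingEnd ℂ) (k * r) := by simp
  unfold f
  rw [h, Complex.sin_conj]
  simp only [map_eq_zero]
  split_ifs <;> simp [Complex.conj_ofNat]

lemma numer_conj (R r : ℝ) (k : ℂ) :
    numer R r ((starRingEnd ℂ) k) = (starRingEnd ℂ) (numer R r k) := by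
  simp only [numer, f_conj, map_mul, map_pow, ← exp_conj, map_neg, conj_ofReal]

lemma norm_sin_le_exp (w : ℂ) : ‖Complex.sin w‖ ≤ Real.exp ‖w‖ := by
  have h1 : ‖cexp (-w * I)‖ ≤ Real.exp ‖w‖ := by
    simpa using norm_exp_le_exp_norm (-w * I)
  have h2 : ‖cexp (w * I)‖ ≤ Real.exp ‖w‖ := by
    simpa using norm_exp_le_exp_norm (w * I)
  rw [Complex.sin, norm_div, norm_mul, norm_I, mul_one, RCLike.norm_ofNat, div_le_iff₀ two_pos]
  refine (norm_sub_le _ _).trans ?_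
  linarith

/-- One form serves both cases. At `r = 0` the convention `1 / 0 = 0` gives the constant `4π`, and
the extra `1` in the exponent absorbs the second factor `‖k‖`. -/
lemma norm_sq_mul_f_le {r : ℝ} (hr : 0 ≤ r) (k : ℂ) :
    ‖k ^ 2 * f k r‖ ≤ 4 * Real.pi * (1 + 1 / r) * ‖k‖ * Real.exp ((r + 1) * ‖k‖) := by
  have hpi := Real.pi_pos
  rcases hr.eq_or_lt with rfl | hr
  · rw [sq_mul_f_zero, norm_mul, norm_mul, norm_pow, norm_real, Real.norm_of_nonneg hpi.le,
      RCLike.norm_ofNat, div_zero, add_zero, mul_one, zero_add, one_mul, sq, ← mul_assoc]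
    gcongr
    have := Real.add_one_le_exp ‖k‖
    linarith
  · rw [sq_mul_f_of_ne_zero hr.ne', norm_mul, norm_mul, norm_div, norm_mul, norm_real, norm_real,
      Real.norm_of_nonneg hpi.le, Real.norm_of_nonneg hr.le, RCLike.norm_ofNat]
    have h1 : ‖Complex.sin (k * r)‖ ≤ Real.exp ((r + 1) * ‖k‖) := by
      refine (norm_sin_le_exp _).trans (Real.exp_le_exp.2 ?_)
      rw [norm_mul, norm_real, Real.norm_of_nonneg hr.le]
      nlinarith [norm_nonneg k]
    have h2 : 4 * Real.pi / r ≤ 4 * Real.pi * (1 + 1 / r) := by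
      rw [mul_add, mul_one_div]
      linarith
    rw [mul_assoc (_ * _) ‖k‖]
    gcongr

/-- On the sector `Im k ≤ (3/4) Re k`, hence `Re k² ≥ (7/25) ‖k‖²`, and the Gaussian beats the
exponential growth of `f`. The constant comes from completing the square in `(r + 2)‖k‖ - a‖k‖²`,
where one unit of the linear term is reserved for `exp(-‖k‖)`. -/
lemma exists_norm_numer_le {R r : ℝ} (hR : 0 < R) (hr : 0 ≤ r) :
    ∃ C, ∀ k ∈ raySector, ‖numer R r k‖ ≤ C * ‖k‖ * Real.exp (-‖k‖) := by
  set a : ℝ := 7 / 25 * R ^ 2 with ha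
  have ha0 : 0 < a := by positivity
  refine ⟨4 * Real.pi * (1 + 1 / r) * Real.exp ((r + 2) ^ 2 / (4 * a)), fun k hk => ?_⟩
  have hre := re_nonneg_of_mem_raySector hk
  have h1 : ‖cexp (-(k ^ 2 * R ^ 2))‖ ≤ Real.exp (-(a * ‖k‖ ^ 2)) := by
    rw [norm_exp, Real.exp_le_exp, neg_re, neg_le_neg_iff, Complex.sq_norm, normSq_apply,
      ← ofReal_pow, re_mul_ofReal, ha, sq k, mul_re]
    have h2 := hk.1
    have h3 := hk.2
    nlinarith [sq_nonneg R, mul_nonneg (sq_nonneg R)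
      (show 0 ≤ 9 * (k.re * k.re) - 16 * (k.im * k.im) by nlinarith)]
  have h2 : -(a * ‖k‖ ^ 2) + (r + 1) * ‖k‖ ≤ (r + 2) ^ 2 / (4 * a) + -‖k‖ := by
    have : (r + 2) * ‖k‖ - a * ‖k‖ ^ 2 ≤ (r + 2) ^ 2 / (4 * a) := by
      rw [le_div_iff₀ (by positivity)]
      nlinarith [sq_nonneg (2 * a * ‖k‖ - (r + 2))]
    linarith
  have hpos : 0 ≤ 4 * Real.pi * (1 + 1 / r) := by positivity
  calc ‖numer R r k‖ = ‖cexp (-(k ^ 2 * R ^ 2))‖ * ‖k ^ 2 * f k r‖ := norm_mul _ _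
    _ ≤ Real.exp (-(a * ‖k‖ ^ 2)) *
        (4 * Real.pi * (1 + 1 / r) * ‖k‖ * Real.exp ((r + 1) * ‖k‖)) := by
      gcongr
      exact norm_sq_mul_f_le hr k
    _ = 4 * Real.pi * (1 + 1 / r) * ‖k‖ * Real.exp (-(a * ‖k‖ ^ 2) + (r + 1) * ‖k‖) := by
      rw [Real.exp_add]
      ring
    _ ≤ 4 * Real.pi * (1 + 1 / r) * ‖k‖ * Real.exp ((r + 2) ^ 2 / (4 * a) + -‖k‖) := by
      gcongr
    _ = _ := by
      rw [Real.exp_add]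
      ring

lemma I_mul_Gam {c : ℝ} (hc : 0 < c) (R r : ℝ) (y : ℂ) :
    I * c * Gam c R r (-I * y) = lineCauchy (numer R r) (y / c) := by
  have hc' : (c : ℂ) ≠ 0 := by exact_mod_cast hc.ne'
  have hI := I_ne_zero
  rw [Gam, ← mul_assoc, mul_one_div_cancel (mul_ne_zero hI hc'), one_mul, lineCauchy]
  congr 1
  ext t
  have h : -I * y / (I * c) + t = t - y / c := by
    field_simp
    ring
  rw [h, numer]
  push_cast
  ring

lemma jump_eq (c R r : ℝ) (y : ℂ) : jump c R r y = 2 * Real.pi * I * numer R r (y / c) := by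
  rw [jump, numer, div_pow, div_mul_eq_mul_div]
  ring

lemma lineCauchy_conj {h : ℂ → ℂ} (hh : ∀ k, h ((starRingEnd ℂ) k) = (starRingEnd ℂ) (h k))
    (z : ℂ) : lineCauchy h ((starRingEnd ℂ) z) = (starRingEnd ℂ) (lineCauchy h z) := by
  rw [lineCauchy, lineCauchy, ← integral_conj]
  congr 1
  ext t
  rw [map_div₀, map_sub, conj_ofReal, ← hh, conj_ofReal]

lemma div_mem_openSector {c : ℝ} (hc : 0 < c) {y : ℂ} (hy : y ∈ openSector) :
    y / c ∈ openSector := by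
  have h : |y.im| < 2 / 3 * y.re := hy
  show |(y / c).im| < 2 / 3 * (y / c).re
  rw [div_ofReal_im, div_ofReal_re, abs_div, abs_of_pos hc, ← mul_div_assoc]
  gcongr

section
variable {c R r : ℝ}

lemma tendsto_rayCauchy_of_im_eq_zero (hR : 0 < R) (hr : 0 ≤ r) {z : ℂ} (hz : z ∈ openSector)
    (d : ℂ) : Tendsto (fun ε : ℝ => rayCauchy (numer R r) (z + ε * d)) (𝓝[>] 0)
      (𝓝 (rayCauchy (numer R r) z)) := by
  obtain ⟨C, hC⟩ := exists_norm_numer_le hR hr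
  have hcont : ContinuousAt (rayCauchy (numer R r)) z :=
    (differentiableOn_rayCauchy (differentiable_numer R r) hC).continuousOn.continuousAt
      (isOpen_openSector.mem_nhds hz)
  have h1 : Tendsto (fun ε : ℝ => z + ε * d) (𝓝[>] 0) (𝓝 z) :=
    (Continuous.tendsto' (by fun_prop) _ _ (by simp)).mono_left nhdsWithin_le_nhds
  exact hcont.tendsto.comp h1

lemma eventually_mem_openSector {z : ℂ} (hz : z ∈ openSector) (d : ℂ) :
    ∀ᶠ ε : ℝ in 𝓝[>] 0, z + ε * d ∈ openSector := by
  have h1 : Tendsto (fun ε : ℝ => z + ε * d) (𝓝[>] 0) (𝓝 z) :=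
    (Continuous.tendsto' (by fun_prop) _ _ (by simp)).mono_left nhdsWithin_le_nhds
  exact h1.eventually (isOpen_openSector.mem_nhds hz)

/-- The boundary value from below of the Cauchy integral on the positive real axis. -/
lemma tendsto_lineCauchy_below (hR : 0 < R) (hr : 0 ≤ r) {z : ℂ} (hz : z ∈ openSector)
    (hz' : z.im = 0) {b : ℝ} (hb : 0 < b) :
    Tendsto (fun ε : ℝ => lineCauchy (numer R r) (z + ε * (-b * I))) (𝓝[>] 0)
      (𝓝 (rayCauchy (numer R r) z)) := by
  obtain ⟨C, hC⟩ := exists_norm_numer_le hR hr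
  refine (tendsto_rayCauchy_of_im_eq_zero hR hr hz (-b * I)).congr' ?_
  filter_upwards [eventually_mem_openSector hz (-b * I), self_mem_nhdsWithin] with ε h1 h2
  refine (lineCauchy_eq_of_im_neg (differentiable_numer R r) hC h1 ?_).symm
  have : (0 : ℝ) < ε := h2
  simp [hz']
  positivity

/-- On the sector, `A⁺` is the Cauchy integral along the rotated half line. -/
theorem Aplus_eq_rayCauchy (hc : 0 < c) (hR : 0 < R) (hr : 0 ≤ r) {y : ℂ}
    (hy : y ∈ openSector) : Aplus c R r y = rayCauchy (numer R r) (y / c) := by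
  obtain ⟨C, hC⟩ := exists_norm_numer_le hR hr
  have hd := differentiable_numer R r
  have hyc := div_mem_openSector hc hy
  have him : (y / c).im = y.im / c := div_ofReal_im y c
  have hc' : (c : ℂ) ≠ 0 := by exact_mod_cast hc.ne'
  unfold Aplus
  split_ifs with h1 h2
  · rw [I_mul_Gam hc, lineCauchy_eq_of_im_neg hd hC hyc]
    rw [him]
    exact div_neg_of_neg_of_pos h1 hc
  · rw [I_mul_Gam hc, jump_eq, lineCauchy_eq_of_im_pos hd hC hyc]
    · ring
    · rw [him]
      exact div_pos h2 hc
  · have h0 : y.im = 0 := le_antisymm (not_lt.1 h2) (not_lt.1 h1)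
    refine Tendsto.limUnder_eq ?_
    refine (tendsto_lineCauchy_below hR hr hyc (by rw [him, h0, zero_div])
      (inv_pos.2 hc)).congr fun ε => ?_
    have e : -I * y - ε = -I * (y - ε * I) := by
      linear_combination (-ε : ℂ) * I_sq
    rw [e, I_mul_Gam hc]
    congr 1
    push_cast
    field_simp
    ring

/-- `A⁻` is the complex conjugate of `A⁺`. -/
theorem Aminus_conj (hc : 0 < c) (hR : 0 < R) (hr : 0 ≤ r) {y : ℂ}
    (hy : y ∈ openSector) :
    Aminus c R r ((starRingEnd ℂ) y) = (starRingEnd ℂ) (Aplus c R r y) := by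
  have hG : ∀ w : ℂ, I * c * Gam c R r (-I * (starRingEnd ℂ) w) =
      (starRingEnd ℂ) (I * c * Gam c R r (-I * w)) := fun w => by
    rw [I_mul_Gam hc, I_mul_Gam hc, ← lineCauchy_conj (numer_conj R r), map_div₀, conj_ofReal]
  have hJ : jump c R r ((starRingEnd ℂ) y) = -(starRingEnd ℂ) (jump c R r y) := by
    rw [jump_eq, jump_eq, ← conj_ofReal c, ← map_div₀, numer_conj]
    simp [Complex.conj_ofNat]
  have hc' : (c : ℂ) ≠ 0 := by exact_mod_cast hc.ne'
  rcases lt_trichotomy y.im 0 with h | h | h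
  · rw [Aminus, Aplus, if_pos (by simpa using h), if_pos h, hG]
  · have hyc := div_mem_openSector hc hy
    have him : (y / c).im = y.im / c := div_ofReal_im y c
    rw [Aplus_eq_rayCauchy hc hR hr hy]
    have e0 : (starRingEnd ℂ) y = y := conj_eq_iff_im.2 h
    rw [Aminus, e0, if_neg (by rw [h]; exact lt_irrefl _), if_neg (by rw [h]; exact lt_irrefl _)]
    refine Tendsto.limUnder_eq ?_
    have := (continuous_conj.tendsto _).comp (tendsto_lineCauchy_below hR hr hyc
      (by rw [him, h, zero_div]) (inv_pos.2 hc))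
    refine this.congr fun ε => ?_
    have e : -I * y + ε = -I * (starRingEnd ℂ) (y - ε * I) := by
      rw [map_sub, e0, map_mul, conj_ofReal, conj_I]
      linear_combination (ε : ℂ) * I_sq
    rw [e, hG, I_mul_Gam hc, Function.comp_apply]
    congr 2
    push_cast
    field_simp
    ring
  · rw [Aminus, Aplus, if_neg (by simp; exact h.le), if_pos (by simpa using h),
      if_neg h.le.not_gt, if_pos h, hG, hJ, map_sub]
    ring

/-- The imaginary part of `A⁺` on the positive real axis (Sokhotski–Plemelj). -/
theorem Aplus_sub_conj_of_pos (hc : 0 < c) (hR : 0 < R) (hr : 0 ≤ r) {y : ℝ} (hy : 0 < y) :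
    Aplus c R r y - (starRingEnd ℂ) (Aplus c R r y) =
      -(2 * Real.pi * I * numer R r (y / c)) := by
  obtain ⟨C, hC⟩ := exists_norm_numer_le hR hr
  have hd := differentiable_numer R r
  have hys : (y : ℂ) ∈ openSector := by
    show |(y : ℂ).im| < 2 / 3 * (y : ℂ).re
    simp [hy]
  have hyc := div_mem_openSector hc hys
  rw [Aplus_eq_rayCauchy hc hR hr hys]
  set z : ℂ := (y : ℂ) / c with hz
  have hzr : (starRingEnd ℂ) z = z := by
    rw [hz, map_div₀, conj_ofReal, conj_ofReal]
  have hzi : z.im = 0 := conj_eq_iff_im.1 hzr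
  have l1 : Tendsto (fun ε : ℝ => rayCauchy (numer R r) (z + ε * I) +
      2 * Real.pi * I * numer R r (z + ε * I)) (𝓝[>] 0)
      (𝓝 (rayCauchy (numer R r) z + 2 * Real.pi * I * numer R r z)) := by
    refine (tendsto_rayCauchy_of_im_eq_zero hR hr hyc I).add ?_
    exact ((Continuous.tendsto' (continuous_const.mul (hd.continuous.comp (by fun_prop))) _ _
      (by simp)).mono_left nhdsWithin_le_nhds)
  have l2 := (continuous_conj.tendsto _).comp (tendsto_lineCauchy_below hR hr hyc hzi one_pos)
  -- At `z + iε` the line integral equals the rotated one plus the pole term. By reflection it is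
  -- also the conjugate of its value at `z - iε`, which has no pole term. Letting `ε → 0` identifies
  -- the two limits.
  have := tendsto_nhds_unique_of_eventuallyEq l1 l2 (by
    filter_upwards [eventually_mem_openSector hyc I, self_mem_nhdsWithin] with ε h1 h2
    have h3 : (0 : ℝ) < ε := h2
    rw [← lineCauchy_eq_of_im_pos hd hC h1 (by simp [hzi, h3]), Function.comp_apply,
      ← lineCauchy_conj (numer_conj R r)]
    congr 1
    simp [hzr])
  rw [← this]
  ring

end

/-! ### Geometry of the disk and sectors; determinants near the identity -/

lemma mem_openSector_of_dist_le {Ω ρ : ℝ} (hΩ : 0 < Ω) (hρ : ρ ≤ Ω / 4) {z : ℂ}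
    (hz : dist z Ω ≤ ρ) : |z.im| ≤ Ω / 4 ∧ 3 * Ω / 4 ≤ z.re ∧ z ∈ openSector := by
  rw [dist_eq] at hz
  have h1 : |z.im| ≤ Ω / 4 := by
    have := abs_im_le_norm (z - Ω)
    simp only [sub_im, ofReal_im, sub_zero] at this
    linarith
  have h2 : 3 * Ω / 4 ≤ z.re := by
    have := (abs_le.1 (abs_re_le_norm (z - Ω))).1
    simp only [sub_re, ofReal_re] at this
    linarith
  refine ⟨h1, h2, ?_⟩
  show |z.im| < 2 / 3 * z.re
  linarith

lemma mem_sectorA_of_dist_le {Ω ρ : ℝ} (hΩ : 0 < Ω) (hρ : ρ ≤ Ω / 4) {z : ℂ}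
    (hz : dist z Ω ≤ ρ) : z ∈ sectorA := by
  obtain ⟨h1, h2, -⟩ := mem_openSector_of_dist_le hΩ hρ hz
  have hre : 0 < z.re := by linarith
  have hn : 0 < ‖z‖ := hre.trans_le (re_le_norm z)
  have hq : |z.im / ‖z‖| ≤ 1 / 2 := by
    rw [abs_div, abs_of_pos hn, div_le_iff₀ hn]
    have := re_le_norm z
    linarith
  have hq' := abs_le.1 hq
  have hpi := Real.pi_pos
  have hmem : Real.pi / 6 ∈ Set.Icc (-(Real.pi / 2)) (Real.pi / 2) := by
    constructor <;> linarith
  refine ⟨‖z‖, arg z, hn, ?_, ?_, (norm_mul_exp_arg_mul_I z).symm⟩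
  · rw [arg_of_re_nonneg hre.le, ← Real.arcsin_sin' hmem, ← Real.arcsin_neg, Real.sin_pi_div_six]
    exact Real.monotone_arcsin hq'.1
  · rw [arg_of_re_nonneg hre.le, ← Real.arcsin_sin' hmem, Real.sin_pi_div_six]
    exact Real.monotone_arcsin hq'.2

/-- The boundary slope is `tan(π/6) = 1/√3 < 2/3`, leaving room for analyticity on a neighbourhood
of the closed sector. -/
lemma sectorA_subset_openSector : sectorA ⊆ openSector := by
  rintro z ⟨ρ, θ, hρ, h1, h2, rfl⟩
  have hpi := Real.pi_pos
  have hcos : √3 / 2 ≤ Real.cos θ := by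
    rw [← Real.cos_pi_div_six, ← Real.cos_abs θ]
    exact Real.cos_le_cos_of_nonneg_of_le_pi (abs_nonneg _) (by linarith) (abs_le.2 ⟨h1, h2⟩)
  have hs1 : Real.sin θ ≤ 1 / 2 := by
    rw [← Real.sin_pi_div_six]
    exact Real.sin_le_sin_of_le_of_le_pi_div_two (by linarith) (by linarith) h2
  have hs2 : -(1 / 2) ≤ Real.sin θ := by
    rw [← Real.sin_pi_div_six, ← Real.sin_neg]
    exact Real.sin_le_sin_of_le_of_le_pi_div_two (by linarith) (by linarith) h1
  have h3 : (3 : ℝ) / 2 < √3 := Real.lt_sqrt_of_sq_lt (by norm_num)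
  show |(ρ * cexp (θ * I)).im| < 2 / 3 * (ρ * cexp (θ * I)).re
  rw [re_ofReal_mul, im_ofReal_mul, exp_ofReal_mul_I_re, exp_ofReal_mul_I_im, abs_mul,
    abs_of_pos hρ]
  have h4 : |Real.sin θ| ≤ 1 / 2 := abs_le.2 ⟨hs2, hs1⟩
  have h5 : |Real.sin θ| < 2 / 3 * Real.cos θ := by linarith
  calc ρ * |Real.sin θ| < ρ * (2 / 3 * Real.cos θ) := by gcongr
    _ = _ := by ring

lemma conj_mem_openSector {z : ℂ} (hz : z ∈ openSector) : (starRingEnd ℂ) z ∈ openSector := by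
  have h : |z.im| < 2 / 3 * z.re := hz
  show |((starRingEnd ℂ) z).im| < 2 / 3 * ((starRingEnd ℂ) z).re
  simpa using h

lemma ofReal_mem_openSector {t : ℝ} (ht : 0 < t) : (t : ℂ) ∈ openSector := by
  show |(t : ℂ).im| < 2 / 3 * (t : ℂ).re
  simp [ht]

lemma listsRoots_of_order {N : ℕ} {F : ℂ → ℂ} {S : Set ℂ} {y : Fin N → ℂ}
    (hF : AnalyticOnNhd ℂ F S) (hy : ∀ j, y j ∈ S)
    (ho : ∀ z ∈ S, analyticOrderAt F z = ((Finset.univ.filter fun j => y j = z).card : ℕ∞)) :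
    ListsRoots F S y := by
  refine ⟨hF, hy, fun z hz => ⟨?_, ho z hz⟩⟩
  rw [← (hF z hz).analyticOrderAt_ne_zero, ho z hz]
  simp [Finset.filter_eq_empty_iff]

lemma exists_norm_det_one_add_sub_one_lt (N : ℕ) :
    ∃ δ : ℝ, 0 < δ ∧ ∀ B : Matrix (Fin N) (Fin N) ℂ, (∀ i j, ‖B i j‖ < δ) →
      ‖(1 + B).det - 1‖ < 1 := by
  have hc : Continuous fun B : Fin N → Fin N → ℂ => (1 + Matrix.of B).det :=
    (continuous_const.add continuous_id).matrix_det
  obtain ⟨δ, hδ, h⟩ := Metric.continuousAt_iff.1 (hc.continuousAt (x := 0)) 1 one_pos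
  suffices key : ∀ B : Fin N → Fin N → ℂ, (∀ i j, ‖B i j‖ < δ) →
      ‖(1 + Matrix.of B).det - 1‖ < 1 from ⟨δ, hδ, fun B hB => key (fun i j => B i j) hB⟩
  intro B hB
  have h1 := h (x := B) (by
    rw [dist_pi_lt_iff hδ]
    intro i
    rw [dist_pi_lt_iff hδ]
    intro j
    simpa using hB i j)
  have h2 : (1 + Matrix.of (0 : Fin N → Fin N → ℂ)).det = 1 := by
    rw [show Matrix.of (0 : Fin N → Fin N → ℂ) = 0 from rfl, add_zero, Matrix.det_one]
  rw [h2, dist_eq] at h1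
  exact h1

/-! ### The resonance determinant and the sign of its roots -/

section
variable {N : ℕ} {Ω c R : ℝ} {x : Fin N → EuclideanSpace ℝ (Fin 3)}

lemma differentiableOn_AplusMatrix (hc : 0 < c) (hR : 0 < R) (j l : Fin N) :
    DifferentiableOn ℂ (fun y => AplusMatrix c R x y j l) openSector := by
  obtain ⟨C, hC⟩ := exists_norm_numer_le hR (dist_nonneg (x := x j) (y := x l))
  have h1 : DifferentiableOn ℂ (fun y : ℂ => rayCauchy (numer R (dist (x j) (x l))) (y / c))
      openSector :=
    (differentiableOn_rayCauchy (differentiable_numer R _) hC).comp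
      (differentiable_id.div_const _).differentiableOn fun y hy => div_mem_openSector hc hy
  exact h1.congr fun y hy => Aplus_eq_rayCauchy hc hR dist_nonneg hy

lemma exists_norm_AplusMatrix_le (hc : 0 < c) (hR : 0 < R) :
    ∃ M : ℝ, 0 < M ∧ ∀ y ∈ openSector, ∀ j l, ‖AplusMatrix c R x y j l‖ ≤ M := by
  choose C hC using fun j l : Fin N =>
    exists_norm_numer_le hR (dist_nonneg (x := x j) (y := x l))
  have hC0 : ∀ j l, 0 ≤ C j l := fun j l => constant_nonneg_of_bound (hC j l)
  -- The summand `1` makes the bound strictly positive even for `N = 0`; it is later divided by.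
  refine ⟨1 + ∑ j, ∑ l, 31 * C j l, ?_, fun y hy j l => ?_⟩
  · have : 0 ≤ ∑ j, ∑ l, 31 * C j l := Finset.sum_nonneg fun j _ =>
      Finset.sum_nonneg fun l _ => mul_nonneg (by norm_num) (hC0 j l)
    linarith
  · have h1 : ‖AplusMatrix c R x y j l‖ ≤ 31 * C j l := by
      rw [AplusMatrix, Matrix.of_apply, Aplus_eq_rayCauchy hc hR dist_nonneg hy]
      exact norm_rayCauchy_le (hC j l) (div_mem_openSector hc hy)
    have h2 : 31 * C j l ≤ ∑ l, 31 * C j l :=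
      Finset.single_le_sum (f := fun l => 31 * C j l)
        (fun l _ => mul_nonneg (by norm_num) (hC0 j l)) (Finset.mem_univ l)
    have h3 : ∑ l, 31 * C j l ≤ ∑ j, ∑ l, 31 * C j l :=
      Finset.single_le_sum (f := fun j => ∑ l, 31 * C j l)
        (fun j _ => Finset.sum_nonneg fun l _ => mul_nonneg (by norm_num) (hC0 j l))
        (Finset.mem_univ j)
    linarith

lemma AminusMatrix_eq_conj (hc : 0 < c) (hR : 0 < R) {y : ℂ} (hy : y ∈ openSector) :
    AminusMatrix c R x y =
      (AplusMatrix c R x ((starRingEnd ℂ) y)).map (starRingEnd ℂ) := by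
  ext j l
  have := Aminus_conj hc hR (dist_nonneg (x := x j) (y := x l)) (conj_mem_openSector hy)
  rw [conj_conj] at this
  exact this

lemma resDet_Aminus_eq_conj (g : ℝ) (hc : 0 < c) (hR : 0 < R) {y : ℂ} (hy : y ∈ openSector) :
    resDet Ω c g (AminusMatrix c R x) y =
      (starRingEnd ℂ) (resDet Ω c g (AplusMatrix c R x) ((starRingEnd ℂ) y)) := by
  rw [resDet, resDet, AminusMatrix_eq_conj hc hR hy, RingHom.map_det]
  congr 1
  ext j l
  simp only [Matrix.add_apply, Matrix.smul_apply, Matrix.map_apply, smul_eq_mul,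
    RingHom.mapMatrix_apply, map_add, map_mul, map_sub, conj_conj, conj_ofReal]
  rw [Matrix.one_apply, apply_ite (starRingEnd ℂ), map_one, map_zero]

lemma analyticOnNhd_resDet (g : ℝ) (hc : 0 < c) (hR : 0 < R) :
    AnalyticOnNhd ℂ (resDet Ω c g (AplusMatrix c R x)) openSector := by
  refine DifferentiableOn.analyticOnNhd ?_ isOpen_openSector
  unfold resDet
  simp_rw [Matrix.det_apply]
  refine DifferentiableOn.fun_sum fun σ _ => ?_
  refine DifferentiableOn.const_smul ?_ _
  refine DifferentiableOn.fun_finsetProd fun i _ => ?_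
  simp only [Matrix.add_apply, Matrix.smul_apply, smul_eq_mul]
  refine DifferentiableOn.add (by fun_prop) ?_
  exact (differentiableOn_AplusMatrix hc hR _ _).const_mul _

lemma resDet_div_pow (g : ℝ) (A : ℂ → Matrix (Fin N) (Fin N) ℂ) {y : ℂ} (hy : y ≠ Ω) :
    resDet Ω c g A y / (y - Ω) ^ N =
      (1 + (((g ^ 2 / ((2 * Real.pi) ^ 3 * c) : ℝ) : ℂ) / (y - Ω)) • A y).det := by
  have h0 : y - Ω ≠ 0 := sub_ne_zero.2 hy
  rw [div_eq_iff (pow_ne_zero _ h0), resDet, mul_comm (Matrix.det _)]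
  have := Matrix.det_smul (1 + (((g ^ 2 / ((2 * Real.pi) ^ 3 * c) : ℝ) : ℂ) / (y - Ω)) • A y)
    (y - Ω)
  rw [Fintype.card_fin] at this
  rw [← this, smul_add, smul_smul, mul_div_cancel₀ _ h0]

/-- The Hermitian form of `A⁺(Ω)` has negative imaginary part. -/
lemma im_form_AplusMatrix_neg (hΩ : 0 < Ω) (hc : 0 < c) (hR : 0 < R) (hx : Function.Injective x)
    {v : Fin N → ℂ} (hv : v ≠ 0) :
    (∑ j, ∑ l, (starRingEnd ℂ) (v j) * AplusMatrix c R x Ω j l * v l).im < 0 := by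
  set S := ∑ j, ∑ l, (starRingEnd ℂ) (v j) * AplusMatrix c R x Ω j l * v l with hS
  set k : ℝ := Ω / c with hk
  set Q := ∑ j, ∑ l, (starRingEnd ℂ) (v j) * f k (dist (x j) (x l)) * v l with hQ
  set κ : ℝ := Real.exp (-(k ^ 2 * R ^ 2)) * k ^ 2 with hκ
  have hk0 : 0 < k := div_pos hΩ hc
  have hκ0 : 0 < κ := by positivity
  have hQpos : 0 < Q.re := re_sum_f_dist_pos hx hk0 hv
  -- The matrix is symmetric because distances are, so conjugating the form amounts to conjugating
  -- the entries. Thus `S - conj S` only sees the entrywise jump.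
  have hconj : (starRingEnd ℂ) S =
      ∑ j, ∑ l, (starRingEnd ℂ) (v j) * (starRingEnd ℂ) (AplusMatrix c R x Ω j l) * v l := by
    rw [hS, map_sum, Finset.sum_congr rfl fun j _ => map_sum _ _ _, Finset.sum_comm]
    refine Finset.sum_congr rfl fun l _ => Finset.sum_congr rfl fun j _ => ?_
    rw [map_mul, map_mul, conj_conj, AplusMatrix, Matrix.of_apply, Matrix.of_apply, dist_comm]
    ring
  have hsub : S - (starRingEnd ℂ) S = -(2 * Real.pi * I * κ) * Q := by
    rw [hconj, hS, ← Finset.sum_sub_distrib, hQ, Finset.mul_sum]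
    refine Finset.sum_congr rfl fun j _ => ?_
    rw [← Finset.sum_sub_distrib, Finset.mul_sum]
    refine Finset.sum_congr rfl fun l _ => ?_
    rw [← sub_mul, ← mul_sub, AplusMatrix, Matrix.of_apply,
      Aplus_sub_conj_of_pos hc hR dist_nonneg hΩ, numer, hκ, hk]
    push_cast
    ring
  rw [sub_conj] at hsub
  have him := congrArg Complex.im hsub
  have e : -(2 * Real.pi * I * κ) * Q = ((-(2 * Real.pi * κ) : ℝ) : ℂ) * (I * Q) := by
    push_cast
    ring
  rw [e] at him
  simp only [im_ofReal_mul, I_im, I_mul_im, mul_one] at him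
  have : 0 < 2 * Real.pi * κ * Q.re := by positivity
  linarith

/-- The form is jointly continuous at each `(Ω, v)`, so compactness of the unit sphere gives a
neighbourhood of `Ω` that works for all unit `v`. Quadratic homogeneity covers the rest. -/
lemma eventually_im_form_AplusMatrix_neg (hΩ : 0 < Ω) (hc : 0 < c) (hR : 0 < R)
    (hx : Function.Injective x) :
    ∀ᶠ y : ℂ in 𝓝 (Ω : ℂ), ∀ v : Fin N → ℂ, v ≠ 0 →
      (∑ j, ∑ l, (starRingEnd ℂ) (v j) * AplusMatrix c R x y j l * v l).im < 0 := by
  have hs : ∀ᶠ y : ℂ in 𝓝 (Ω : ℂ), ∀ v ∈ Metric.sphere (0 : Fin N → ℂ) 1,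
      (∑ j, ∑ l, (starRingEnd ℂ) (v j) * AplusMatrix c R x y j l * v l).im < 0 := by
    refine (isCompact_sphere (0 : Fin N → ℂ) 1).eventually_forall_of_forall_eventually
      fun v hv => ?_
    have hv0 : v ≠ 0 := by
      rintro rfl
      simp at hv
    have hA : ∀ j l, ContinuousAt (fun p : ℂ × (Fin N → ℂ) => AplusMatrix c R x p.1 j l)
        ((Ω : ℂ), v) := fun j l => by
      have h1 : ContinuousAt (fun y => AplusMatrix c R x y j l) (Ω : ℂ) :=
        (differentiableOn_AplusMatrix hc hR j l).continuousOn.continuousAt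
          (isOpen_openSector.mem_nhds (ofReal_mem_openSector hΩ))
      exact ContinuousAt.comp (f := Prod.fst) (x := ((Ω : ℂ), v)) h1 continuousAt_fst
    have hcont : ContinuousAt (fun p : ℂ × (Fin N → ℂ) =>
        (∑ j, ∑ l, (starRingEnd ℂ) (p.2 j) * AplusMatrix c R x p.1 j l * p.2 l).im)
        ((Ω : ℂ), v) := by
      refine continuous_im.continuousAt.comp ?_
      refine tendsto_finsetSum _ fun j _ => tendsto_finsetSum _ fun l _ => ?_
      refine ContinuousAt.mul (ContinuousAt.mul ?_ (hA j l)) ?_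
      · exact (continuous_conj.comp ((continuous_apply j).comp continuous_snd)).continuousAt
      · exact ((continuous_apply l).comp continuous_snd).continuousAt
    exact hcont.eventually_lt_const (im_form_AplusMatrix_neg hΩ hc hR hx hv0)
  filter_upwards [hs] with y hy v hv
  have hn : 0 < ‖v‖ := norm_pos_iff.2 hv
  have h1 := hy (((‖v‖⁻¹ : ℝ) : ℂ) • v) (by
    rw [mem_sphere_zero_iff_norm, norm_smul, norm_real, norm_inv, norm_norm,
      inv_mul_cancel₀ hn.ne'])
  have e : ∑ j, ∑ l, (starRingEnd ℂ) ((((‖v‖⁻¹ : ℝ) : ℂ) • v) j) * AplusMatrix c R x y j l *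
      (((‖v‖⁻¹ : ℝ) : ℂ) • v) l = ((‖v‖⁻¹ * ‖v‖⁻¹ : ℝ) : ℂ) *
      ∑ j, ∑ l, (starRingEnd ℂ) (v j) * AplusMatrix c R x y j l * v l := by
    simp_rw [Finset.mul_sum]
    refine Finset.sum_congr rfl fun j _ => Finset.sum_congr rfl fun l _ => ?_
    simp only [Pi.smul_apply, smul_eq_mul, map_mul, conj_ofReal]
    push_cast
    ring
  rw [e, im_ofReal_mul] at h1
  have h2 : 0 < ‖v‖⁻¹ * ‖v‖⁻¹ := by positivity
  by_contra h3
  push Not at h3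
  exact absurd h1 (not_lt.2 (mul_nonneg h2.le h3))

/-- A zero of the determinant near which the form of `A` has negative imaginary part lies in the
upper half-plane. -/
lemma im_pos_of_resDet_eq_zero {g : ℝ} (hg : 0 < g) (hc : 0 < c)
    {A : ℂ → Matrix (Fin N) (Fin N) ℂ} {y : ℂ} (h0 : resDet Ω c g A y = 0)
    (hA : ∀ v : Fin N → ℂ, v ≠ 0 → (∑ j, ∑ l, (starRingEnd ℂ) (v j) * A y j l * v l).im < 0) :
    0 < y.im := by
  obtain ⟨v, hv, hmul⟩ := Matrix.exists_mulVec_eq_zero_iff.2 h0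
  set ε : ℝ := g ^ 2 / ((2 * Real.pi) ^ 3 * c) with hε
  have hpi := Real.pi_pos
  have hε0 : 0 < ε := by positivity
  set S := ∑ j, ∑ l, (starRingEnd ℂ) (v j) * A y j l * v l with hS
  have hneg : S.im < 0 := hA v hv
  set n : ℝ := ∑ j, normSq (v j) with hn
  have hn0 : 0 < n := by
    obtain ⟨j, hj⟩ := Function.ne_iff.1 hv
    exact Finset.sum_pos' (fun j _ => normSq_nonneg _) ⟨j, Finset.mem_univ j, normSq_pos.2 hj⟩
  have key : (y - Ω) * (n : ℂ) + (ε : ℂ) * S = 0 := by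
    have h1 : ∀ j, (y - Ω) * v j + (ε : ℂ) * ∑ l, A y j l * v l = 0 := fun j => by
      have := congrFun hmul j
      rw [Matrix.add_mulVec, Matrix.smul_mulVec, Matrix.smul_mulVec, Matrix.one_mulVec] at this
      simpa [Matrix.mulVec, dotProduct] using this
    have h2 : ∑ j, (starRingEnd ℂ) (v j) *
        ((y - Ω) * v j + (ε : ℂ) * ∑ l, A y j l * v l) = 0 := by
      simp [h1]
    rw [← h2, hn, hS, ofReal_sum, Finset.mul_sum, Finset.mul_sum, ← Finset.sum_add_distrib]
    refine Finset.sum_congr rfl fun j _ => ?_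
    rw [normSq_eq_conj_mul_self, mul_add, ← mul_assoc _ (ε : ℂ), mul_comm _ (ε : ℂ), mul_assoc (ε : ℂ),
      Finset.mul_sum (a := (starRingEnd ℂ) (v j))]
    congr 1
    · ring
    · congr 1
      exact Finset.sum_congr rfl fun l _ => mul_assoc _ _ _
  have him := congrArg Complex.im key
  rw [add_im, im_mul_ofReal, im_ofReal_mul, sub_im, ofReal_im, sub_zero, zero_im] at him
  nlinarith [mul_pos hε0 (neg_pos.2 hneg)]

end

end AtomField

/-! ### Choice of constants and conclusion -/

theorem mainTheorem6 (Ω c R : ℝ) (hΩ : 0 < Ω) (hc : 0 < c) (hR : 0 < R)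
    (N : ℕ) (x : Fin N → EuclideanSpace ℝ (Fin 3)) (hx : Function.Injective x) :
    ∃ G₀ : ℝ, 0 < G₀ ∧ ∃ R₀ : ℝ, 0 < R₀ ∧ R₀ < Ω * Real.sin (Real.pi / 8) ∧
      ∀ g : ℝ, 0 < g → g < G₀ →
        ∃ y : Fin N → ℂ,
          (∀ j, y j ∈ Metric.ball (Ω : ℂ) R₀ ∧ y j ∈ AtomField.sectorA ∧ 0 < (y j).im) ∧
          AtomField.ListsRoots (AtomField.resDet Ω c g (AtomField.AplusMatrix c R x))
            (Metric.ball (Ω : ℂ) R₀) y ∧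
          AtomField.ListsRoots (AtomField.resDet Ω c g (AtomField.AplusMatrix c R x))
            AtomField.sectorA y ∧
          AtomField.ListsRoots (AtomField.resDet Ω c g (AtomField.AminusMatrix c R x))
            (Metric.ball (Ω : ℂ) R₀) (fun j => (starRingEnd ℂ) (y j)) ∧
          AtomField.ListsRoots (AtomField.resDet Ω c g (AtomField.AminusMatrix c R x))
            AtomField.sectorA (fun j => (starRingEnd ℂ) (y j)) := by
  open AtomField in
  obtain ⟨R₁, hR₁, hform⟩ := Metric.eventually_nhds_iff.1
    (eventually_im_form_AplusMatrix_neg (x := x) hΩ hc hR hx)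
  obtain ⟨M, hM, hAM⟩ := exists_norm_AplusMatrix_le (x := x) hc hR
  obtain ⟨δ, hδ, hdet⟩ := exists_norm_det_one_add_sub_one_lt N
  have hpi := Real.pi_pos
  -- Below `R₁` the form keeps its sign. Below `Ω / 4` the disk lies in the sector, and the bound by
  -- `Ω sin(π/8)` follows from Jordan's inequality `sin(π/8) ≥ 1/4`.
  set R₀ : ℝ := min R₁ (Ω / 4) / 2 with hR₀
  have hmin : 0 < min R₁ (Ω / 4) := lt_min hR₁ (by positivity)
  have hR₀pos : 0 < R₀ := by positivity
  have hR₀1 : R₀ < R₁ := by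
    have := min_le_left R₁ (Ω / 4)
    linarith
  have hR₀2 : R₀ < Ω / 4 := by
    have := min_le_right R₁ (Ω / 4)
    linarith
  have hsin : 1 / 4 ≤ Real.sin (Real.pi / 8) := by
    have := Real.mul_le_sin (x := Real.pi / 8) (by positivity) (by linarith)
    refine le_trans (le_of_eq ?_) this
    field_simp
    norm_num
  set K : ℝ := (2 * Real.pi) ^ 3 * c with hK
  have hK0 : 0 < K := by positivity
  -- This threshold says exactly that `(g²/K) M < δ R₀`, so the entries of `ε A⁺(y)/(y - Ω)` stay
  -- below `δ` whenever `|y - Ω| ≥ R₀`.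
  refine ⟨√(δ * R₀ * K / M), Real.sqrt_pos.2 (by positivity), R₀, hR₀pos, ?_, fun g hg hgG => ?_⟩
  · nlinarith
  have hsmall : g ^ 2 / K * M < δ * R₀ := by
    have := (Real.lt_sqrt hg.le).1 hgG
    rw [lt_div_iff₀ hM] at this
    rw [div_mul_eq_mul_div, div_lt_iff₀ hK0]
    exact this
  set F := resDet Ω c g (AplusMatrix c R x) with hFdef
  have hFan : AnalyticOnNhd ℂ F openSector := analyticOnNhd_resDet g hc hR
  have hne : ∀ z : ℂ, R₀ ≤ dist z Ω → z ≠ Ω := by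
    rintro z hz rfl
    rw [dist_self] at hz
    linarith
  have hfar : ∀ z ∈ openSector, R₀ ≤ dist z Ω → ‖F z / (z - Ω) ^ N - 1‖ < 1 := by
    intro z hz hd
    rw [hFdef, resDet_div_pow g _ (hne z hd)]
    refine hdet _ fun i j => ?_
    rw [Matrix.smul_apply, smul_eq_mul, norm_mul, norm_div, Complex.norm_real,
      Real.norm_of_nonneg (by positivity), div_mul_eq_mul_div]
    rw [Complex.dist_eq] at hd
    rw [div_lt_iff₀ (hR₀pos.trans_le hd)]
    calc g ^ 2 / K * ‖AplusMatrix c R x z i j‖ ≤ g ^ 2 / K * M := by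
          gcongr
          exact hAM z hz i j
      _ < δ * R₀ := hsmall
      _ ≤ δ * ‖z - Ω‖ := by gcongr
  have hcb : ∀ z ∈ Metric.closedBall (Ω : ℂ) R₀, z ∈ openSector := fun z hz =>
    (mem_openSector_of_dist_le hΩ hR₀2.le hz).2.2
  have hbA : ∀ z ∈ Metric.ball (Ω : ℂ) R₀, z ∈ sectorA := fun z hz =>
    mem_sectorA_of_dist_le hΩ hR₀2.le (Metric.mem_ball.1 hz).le
  obtain ⟨y, hy, hord⟩ := exists_roots_in_ball hR₀pos (N := N)
    (hFan.mono fun z hz => hcb z hz)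
    (fun z hz => hfar z (hcb z (Metric.sphere_subset_closedBall hz)) (Metric.mem_sphere.1 hz).ge)
  have hord' : ∀ z ∈ openSector,
      analyticOrderAt F z = ((Finset.univ.filter fun j => y j = z).card : ℕ∞) := by
    intro z hz
    by_cases hzb : z ∈ Metric.closedBall (Ω : ℂ) R₀
    · exact hord z hzb
    · have hd : R₀ < dist z Ω := not_le.1 hzb
      have hFz : F z ≠ 0 := by
        intro h0
        have := hfar z hz hd.le
        rw [h0] at this
        simp at this
      rw [(hFan z hz).analyticOrderAt_eq_zero.2 hFz, eq_comm, Nat.cast_eq_zero,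
        Finset.card_eq_zero, Finset.filter_eq_empty_iff]
      rintro j - rfl
      exact hzb (Metric.ball_subset_closedBall (hy j))
  have hconj : ∀ z ∈ openSector,
      AnalyticAt ℂ (resDet Ω c g (AminusMatrix c R x)) z ∧
      analyticOrderAt (resDet Ω c g (AminusMatrix c R x)) z =
        ((Finset.univ.filter fun j => (starRingEnd ℂ) (y j) = z).card : ℕ∞) := by
    intro z hz
    have hz' := conj_mem_openSector hz
    have h := analyticOrderAt_conj_conj (hFan _ hz') (hord' _ hz')
    rw [Complex.conj_conj] at h
    have heq : resDet Ω c g (AminusMatrix c R x) =ᶠ[𝓝 z]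
        fun w => (starRingEnd ℂ) (F ((starRingEnd ℂ) w)) := by
      filter_upwards [isOpen_openSector.mem_nhds hz] with w hw
      exact resDet_Aminus_eq_conj g hc hR hw
    refine ⟨h.1.congr heq.symm, ?_⟩
    rw [analyticOrderAt_congr heq, h.2]
    congr 2
    ext j
    simp only [Finset.mem_filter, Finset.mem_univ, true_and]
    exact ⟨fun e => by rw [e, Complex.conj_conj], fun e => by rw [← e, Complex.conj_conj]⟩
  have hyc : ∀ j, (starRingEnd ℂ) (y j) ∈ Metric.ball (Ω : ℂ) R₀ := fun j => by
    have := hy j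
    rw [Metric.mem_ball] at this ⊢
    rwa [← Complex.conj_ofReal Ω, Complex.dist_conj_conj]
  have hbo : Metric.ball (Ω : ℂ) R₀ ⊆ openSector := fun z hz =>
    hcb z (Metric.ball_subset_closedBall hz)
  have hroots : ∀ j, F (y j) = 0 := fun j => by
    have ho := hord' (y j) (hbo (hy j))
    rw [← (hFan _ (hbo (hy j))).analyticOrderAt_ne_zero, ho]
    simp only [ne_eq, Nat.cast_eq_zero, Finset.card_eq_zero, Finset.filter_eq_empty_iff]
    exact fun h => h (Finset.mem_univ j) rfl
  refine ⟨y, fun j => ⟨hy j, hbA _ (hy j), ?_⟩, ?_, ?_, ?_, ?_⟩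
  · exact im_pos_of_resDet_eq_zero hg hc (hroots j)
      (hform ((Metric.mem_ball.1 (hy j)).trans hR₀1))
  · exact listsRoots_of_order (hFan.mono hbo) hy fun z hz => hord' z (hbo hz)
  · exact listsRoots_of_order (hFan.mono sectorA_subset_openSector) (fun j => hbA _ (hy j))
      fun z hz => hord' z (sectorA_subset_openSector hz)
  · exact listsRoots_of_order (fun z hz => (hconj z (hbo hz)).1) hyc
      fun z hz => (hconj z (hbo hz)).2
  · exact listsRoots_of_order (fun z hz => (hconj z (sectorA_subset_openSector hz)).1)
      (fun j => hbA _ (hyc j)) fun z hz => (hconj z (sectorA_subset_openSector hz)).2
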